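/- Let $1<\alpha<2$. For integers $k\ge 0$ put $g_k=(-1)^k\binom{\alpha}{k}$ and $$q_k=\left(\tfrac32\right)^{\alpha}\sum_{m=0}^{k}3^{-m}g_m\,g_{k-m}$$ (the coefficients of the power series of $(\tfrac32-2\zeta+\tfrac12\zeta^2)^\alpha$), and put $q_k=0$ for $k<0$. Fix a size $n$. For an integer $p$ let $A_p\in\mathbb R^{n\times n}$ be the Toeplitz matrix with entries $(A_p)_{ij}=q_{p+i-j}$. For integers $p,q,r,s$ and $\bar p,\bar q,\bar r,\bar s$ (with nonzero denominators) put $$A_{p,q}=\frac{q}{q-p}A_p+\frac{p}{p-q}A_q,\qquad A_{p,q,r,s}=\frac{3rs+2\alpha}{3(rs-pq)}A_{p,q}+\frac{3pq+2\alpha}{3(pq-rs)}A_{r,s},$$ $$a=rs-pq,\qquad b=6pqrs(r+s-p-q)+4\alpha\,[rs(r+s)-pq(p+q)]+9\alpha(rs-pq),$$ let $\bar a,\bar b$ be the same expressions in $\bar p,\bar q,\bar r,\bar s$, and, provided that $a\bar b\neq\bar a b$, define the fourth order WSLD matrix $$A^\alpha_{p,q,r,s,\bar p,\bar q,\bar r,\bar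 s}=\frac{a\bar b}{a\bar b-\bar a b}\,A_{p,q,r,s}+\frac{\bar a b}{\bar a b-a\bar b}\,A_{\bar p,\bar q,\bar r,\bar s}.$$ **Theorem (Effective fourth order schemes).** Suppose that either 1. $(p,q,r,s,\bar p,\bar q,\bar r,\bar s)=(1,2,1,-2,1,\bar q,1,\bar s)$ with integers $|\bar q|\ge2$, $|\bar s|\ge2$, $\bar q\,\bar s<0$ and $(\bar q,\bar s)\ne(2,-2)$, or 2. $(p,q,r,s,\bar p,\bar q,\bar r,\bar s)$ is one of $(1,2,1,0,1,2,1,-2)$, $(1,2,1,0,1,-1,1,-2)$, $(1,2,1,-1,1,2,1,-2)$, $(1,2,1,-1,1,-1,1,-2)$, $(1,0,1,-1,1,2,1,-2)$, $(1,0,1,-2,1,2,1,-2)$, $(1,-1,1,-2,1,2,1,-2)$, and that $a\bar b\ne\bar a b$, so that the matrix is defined (this excludes only $(\bar q,\bar s)=(-2,2)$ in case 1, and $\alpha=\tfrac32$ for the fourth tuple in case 2). Then, for every size $n$, every (complex) eigenvalue $\lambda$ of $A^\alpha_{p,q,r,s,\bar p,\bar q,\bar r,\bar s}$ satisfies $\Re\lambda<0$,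 and both $A^\alpha_{p,q,r,s,\bar p,\bar q,\bar r,\bar s}$ and its transpose are negative definite, i.e. $(Ax,x)<0$ for every nonzero $x\in\mathbb R^n$. -/

import Mathlib

/-!  Matrices of the weighted and shifted Lubich difference (WSLD) operators.  -/

namespace WSLD

noncomputable section

/-- The coefficient `g_k = (-1)^k * binom(α, k)` of `ζ^k` in the power series of `(1 - ζ)^α`;
`Ring.choose α k` is the generalized binomial coefficient `α (α - 1) ⋯ (α - k + 1) / k!`. -/
def g (α : ℝ) (k : ℕ) : ℝ := (-1) ^ k * Ring.choose α k

/-- The coefficient of `ζ^k` in the power series of `(3/2 - 2ζ + ζ²/2)^α`, for `k : ℕ`. -/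
def qNat (α : ℝ) (k : ℕ) : ℝ :=
  (3 / 2 : ℝ) ^ α * ∑ m ∈ Finset.range (k + 1), ((3 : ℝ) ^ m)⁻¹ * g α m * g α (k - m)

/-- The same coefficients for `k : ℤ`, with the convention that they vanish for `k < 0`. -/
def qInt (α : ℝ) (k : ℤ) : ℝ := if k < 0 then 0 else qNat α k.toNat

/-- The `n × n` Toeplitz matrix of the Lubich operator shifted by `p`: entry `(i, j)` is
`q_{p + i - j}`. -/
def A1 (α : ℝ) (n : ℕ) (p : ℤ) : Matrix (Fin n) (Fin n) ℝ :=
  Matrix.of fun i j => qInt α (p + (i : ℤ) - (j : ℤ))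

/-- Second order matrix `w_p A_p + w_q A_q`, with `w_p = q/(q-p)` and `w_q = p/(p-q)`. -/
def A2 (α : ℝ) (n : ℕ) (p q : ℤ) : Matrix (Fin n) (Fin n) ℝ :=
  ((q : ℝ) / (q - p)) • A1 α n p + ((p : ℝ) / (p - q)) • A1 α n q

/-- Third order matrix `w_{p,q} A_{p,q} + w_{r,s} A_{r,s}`, with
`w_{p,q} = (3rs + 2α)/(3(rs - pq))` and `w_{r,s} = (3pq + 2α)/(3(pq - rs))`. -/
def A3 (α : ℝ) (n : ℕ) (p q r s : ℤ) : Matrix (Fin n) (Fin n) ℝ :=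
  ((3 * r * s + 2 * α) / (3 * ((r : ℝ) * s - p * q))) • A2 α n p q +
    ((3 * p * q + 2 * α) / (3 * ((p : ℝ) * q - r * s))) • A2 α n r s

/-- `a_{p,q,r,s} = rs - pq`. -/
def a (p q r s : ℤ) : ℝ := (r : ℝ) * s - p * q

/-- `b_{p,q,r,s} = 6pqrs(r+s-p-q) + 4α[rs(r+s) - pq(p+q)] + 9α(rs - pq)`. -/
def b (α : ℝ) (p q r s : ℤ) : ℝ :=
  6 * (p : ℝ) * q * r * s * (r + s - p - q)
    + 4 * α * ((r : ℝ) * s * (r + s) - p * q * (p + q))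
    + 9 * α * ((r : ℝ) * s - p * q)

/-- The condition `a b' ≠ a' b` under which the fourth order weights are defined. -/
def Nondegenerate (α : ℝ) (p q r s p' q' r' s' : ℤ) : Prop :=
  a p q r s * b α p' q' r' s' ≠ a p' q' r' s' * b α p q r s

/-- Fourth order matrix `w A_{p,q,r,s} + w' A_{p',q',r',s'}`, with weights
`w = a b' / (a b' - a' b)` and `w' = a' b / (a' b - a b')`. -/
def A4 (α : ℝ) (n : ℕ) (p q r s p' q' r' s' : ℤ) : Matrix (Fin n) (Fin n) ℝ :=
  (a p q r s * b α p' q' r' s' /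
      (a p q r s * b α p' q' r' s' - a p' q' r' s' * b α p q r s)) • A3 α n p q r s +
    (a p' q' r' s' * b α p q r s /
      (a p' q' r' s' * b α p q r s - a p q r s * b α p' q' r' s')) • A3 α n p' q' r' s'

/-- A real square matrix, not necessarily symmetric, is negative definite if `(A x, x) < 0`
for every nonzero real vector `x`. -/
def IsNegDef {n : ℕ} (A : Matrix (Fin n) (Fin n) ℝ) : Prop :=
  ∀ x : Fin n → ℝ, x ≠ 0 → (A.mulVec x) ⬝ᵥ x < 0

/-- Every complex eigenvalue of the real matrix `A` has negative real part. -/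
def EigenvaluesNegRe {n : ℕ} (A : Matrix (Fin n) (Fin n) ℝ) : Prop :=
  ∀ z : ℂ, Module.End.HasEigenvalue (Matrix.toLin' (A.map (fun t : ℝ => (t : ℂ)))) z → z.re < 0

/-- The seven additional parameter tuples `(p, q, r, s, p', q', r', s')`. -/
def specialTuples : Set (ℤ × ℤ × ℤ × ℤ × ℤ × ℤ × ℤ × ℤ) :=
  {(1, 2, 1, 0, 1, 2, 1, -2),
   (1, 2, 1, 0, 1, -1, 1, -2),
   (1, 2, 1, -1, 1, 2, 1, -2),
   (1, 2, 1, -1, 1, -1, 1, -2),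
   (1, 0, 1, -1, 1, 2, 1, -2),
   (1, 0, 1, -2, 1, 2, 1, -2),
   (1, -1, 1, -2, 1, 2, 1, -2)}

end

end WSLD

namespace WSLD

open MeasureTheory Set

/-! A linear combination of the `A1 α n p` is Toeplitz, and its quadratic form at `x` is the mean
over [-π, π] of its generating function times |Σ x_j e^{ijθ}|². Hence it suffices that the real part
of the generating function is negative on (0, π); transpose and eigenvalues follow from the form
(`isNegDef_of_genFun_re_neg`).

On the unit circle the symbol is R e^{-iαψ} with R > 0 and ψ in (0, π/2) explicit in s = sin(θ/2), c
= cos(θ/2) (`exists_isPhase`). With T(m) = cos(αψ + mθ) the claim becomes `S4 α T … < 0`.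

The third order operators in play agree on quadratic T, so each is `thirdOrder` (shifts 1, 2, -2)
plus multiples of `interpErr`. In case 1 the correction is (24 - 13α)/6 times a weighted average of
two third divided differences of T; a bound M for all of them disposes of the infinite family at
once (`third_order_add_neg`, `S4_case_one_neg`). In case 2 the shifts lie in {-2, …, 2}; four fixed
moments leave one parameter `lam`, multiplying a fourth difference, and only its extreme values
matter (`S4_special`, `fourth_order_neg`).

What remains is A cos(αψ) - B sin(αψ) + K < 0 with A, B, K affine in α. The value at αψ is
controlled by those at ψ and 2ψ, which reduces the claim to finitely many inequalities at α = 1 and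
α = 2 (`sinusoid_affine_neg`). By the formulas for ψ these become polynomial inequalities in s², up
to one square root and odd powers of s, which are estimated. -/

/-! ### Power series of the symbol -/

lemma g_zero (α : ℝ) : g α 0 = 1 := by simp [g]

lemma g_succ (α : ℝ) (k : ℕ) : (k + 1) * g α (k + 1) = (k - α) * g α k := by
  unfold g
  rw [Ring.choose_eq_smul, Ring.choose_eq_smul, descPochhammer_succ_right]
  simp only [Polynomial.smeval_mul, Polynomial.smeval_sub, Polynomial.smeval_X,
    Polynomial.smeval_natCast, Nat.factorial_succ, smul_eq_mul, Nat.cast_mul, Nat.cast_succ,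
    pow_succ, pow_zero]
  have h1 : (k.factorial : ℝ) ≠ 0 := by positivity
  have h2 : (k : ℝ) + 1 ≠ 0 := by positivity
  field_simp
  simp
  ring

lemma g_nonneg {α : ℝ} (h1 : 1 < α) (h2 : α < 2) (k : ℕ) : 0 ≤ g α (k + 2) := by
  induction k with
  | zero =>
    have e1 := g_succ α 0
    have e2 := g_succ α 1
    rw [g_zero] at e1
    norm_num at e1 e2 ⊢
    rw [e1] at e2
    nlinarith
  | succ k ih =>
    have e := g_succ α (k + 2)
    push_cast at e
    have hk : (0 : ℝ) ≤ k := by positivity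
    have : 0 ≤ ((k : ℝ) + 2 + 1) * g α (k + 2 + 1) := by
      rw [e]; exact mul_nonneg (by linarith) ih
    exact nonneg_of_mul_nonneg_right this (by positivity)

/-- The partial sums of `g α` are the coefficients of (1 - ζ)^(α-1). The identity shows that they
are nonpositive from index 1 on, as `g` is nonnegative from index 2 on. -/
lemma mul_sum_g (α : ℝ) (n : ℕ) :
    α * ∑ k ∈ Finset.range (n + 1), g α k = -((n + 1) * g α (n + 1)) := by
  induction n with
  | zero => rw [g_succ]; simp [g_zero]
  | succ n ih =>
    rw [Finset.sum_range_succ, mul_add, ih, g_succ α (n + 1)]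
    push_cast; ring

lemma summable_abs_g {α : ℝ} (h1 : 1 < α) (h2 : α < 2) : Summable fun k => |g α k| := by
  rw [← summable_nat_add_iff 2]
  -- The partial sum of all `g α k` up to index n + 1 is at most 0; moving its first terms 1 and -α
  -- across leaves α - 1.
  refine summable_of_sum_range_le (c := α - 1) (fun _ => abs_nonneg _) fun n => ?_
  have e1 := g_succ α 0
  rw [g_zero] at e1
  have h := mul_sum_g α (n + 1)
  rw [Finset.sum_range_succ', Finset.sum_range_succ'] at h
  have hg := g_nonneg h1 h2 n
  have : ∑ k ∈ Finset.range n, |g α (k + 2)| = ∑ k ∈ Finset.range n, g α (k + 1 + 1) :=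
    Finset.sum_congr rfl fun k _ => abs_of_nonneg (g_nonneg h1 h2 k)
  rw [this]
  norm_num [g_zero] at h e1
  rw [e1] at h
  have hn : (0 : ℝ) ≤ ((n : ℝ) + 1 + 1) * g α (n + 1 + 1) := mul_nonneg (by positivity) hg
  nlinarith

/-- The binomial series of `(1 - z)^α` on the closed unit disc. -/
lemma tsum_g_mul_pow {α : ℝ} (h1 : 1 < α) (h2 : α < 2) {z : ℂ} (hz : ‖z‖ ≤ 1) :
    ∑' k, (g α k : ℂ) * z ^ k = (1 - z) ^ (α : ℂ) := by
  have hs : Summable fun k => ‖(g α k : ℂ)‖ := by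
    simpa using summable_abs_g h1 h2
  have hcl : closure (Metric.ball (0 : ℂ) 1) = Metric.closedBall 0 1 :=
    closure_ball 0 one_ne_zero
  have hL : ContinuousOn (fun z : ℂ => ∑' k, (g α k : ℂ) * z ^ k) (Metric.closedBall 0 1) := by
    refine continuousOn_tsum (fun k => by fun_prop) hs fun k x hx => ?_
    rw [norm_mul, norm_pow]
    exact mul_le_of_le_one_right (norm_nonneg _)
      (pow_le_one₀ (norm_nonneg _) (by simpa using hx))
  have hR : ContinuousOn (fun z : ℂ => (1 - z) ^ (α : ℂ)) (Metric.closedBall 0 1) := by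
    intro x hx
    refine ContinuousAt.continuousWithinAt ?_
    -- At x = 1 the base is 0, off the slit plane; continuity there rests on the exponent having
    -- positive real part.
    by_cases hx1 : x = 1
    · subst hx1
      have := Complex.continuousAt_cpow_zero_of_re_pos (z := (α : ℂ)) (by simp; linarith)
      have h := ContinuousAt.comp (x := (1 : ℂ)) (f := fun z : ℂ => ((1 - z, (α : ℂ)) : ℂ × ℂ))
        (g := fun x : ℂ × ℂ => x.1 ^ x.2) (by simpa using this) (by fun_prop)
      exact h
    · refine ContinuousAt.cpow (by fun_prop) continuousAt_const ?_
      rw [Complex.mem_slitPlane_iff]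
      have hn : ‖x‖ ≤ 1 := by simpa using hx
      have hre := (Complex.re_le_norm x).trans hn
      by_contra! hcon
      apply hx1
      simp at hcon
      exact Complex.ext (by simp; linarith) (by simpa using hcon.2)
  have hEq : EqOn (fun z : ℂ => ∑' k, (g α k : ℂ) * z ^ k) (fun z : ℂ => (1 - z) ^ (α : ℂ))
      (Metric.ball 0 1) := by
    intro x hx
    have := (Complex.one_add_cpow_hasFPowerSeriesOnBall_zero (a := (α : ℂ))).hasSum
      (y := -x) (by simpa [Metric.mem_eball, edist_zero_right, enorm_eq_nnnorm, ← NNReal.coe_lt_one] using hx)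
    have h := this.tsum_eq
    simp only [binomialSeries_apply, List.ofFn_const, List.prod_replicate,
      smul_eq_mul] at h
    simp only
    rw [sub_eq_add_neg, ← zero_add (-x)]
    rw [← h]
    congr 1
    ext k
    rw [neg_pow]
    simp only [g]
    push_cast [Complex.ofReal_choose]
    ring
  have key : EqOn (fun z : ℂ => ∑' k, (g α k : ℂ) * z ^ k) (fun z : ℂ => (1 - z) ^ (α : ℂ))
      (Metric.closedBall 0 1) := by
    refine hEq.of_subset_closure hL hR Metric.ball_subset_closedBall ?_
    rw [hcl]
  exact key (by simpa using hz)


/-- The symbol `(3/2 - 2z + z²/2)^α`, written as a product of principal powers. -/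
noncomputable def symbol (α : ℝ) (z : ℂ) : ℂ :=
  ((3 / 2 : ℝ) ^ α : ℝ) * ((1 - z / 3) ^ (α : ℂ) * (1 - z) ^ (α : ℂ))

lemma hasSum_qNat {α : ℝ} (h1 : 1 < α) (h2 : α < 2) {z : ℂ} (hz : ‖z‖ ≤ 1) :
    Summable (fun k => ‖(qNat α k : ℂ) * z ^ k‖) ∧
      ∑' k, (qNat α k : ℂ) * z ^ k = symbol α z := by
  have hle : ∀ k, ‖(g α k : ℂ) * z ^ k‖ ≤ |g α k| := fun k => by
    rw [norm_mul, norm_pow, Complex.norm_real, Real.norm_eq_abs]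
    exact mul_le_of_le_one_right (abs_nonneg _) (pow_le_one₀ (norm_nonneg _) hz)
  have hz3 : ‖z / 3‖ ≤ 1 := by
    rw [norm_div]; norm_num; linarith
  have hle3 : ∀ k, ‖(g α k : ℂ) * (z / 3) ^ k‖ ≤ |g α k| := fun k => by
    rw [norm_mul, norm_pow, Complex.norm_real, Real.norm_eq_abs]
    exact mul_le_of_le_one_right (abs_nonneg _) (pow_le_one₀ (norm_nonneg _) hz3)
  have hs := Summable.of_nonneg_of_le (fun _ => norm_nonneg _) hle (summable_abs_g h1 h2)
  have hs3 := Summable.of_nonneg_of_le (fun _ => norm_nonneg _) hle3 (summable_abs_g h1 h2)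
  have hq : ∀ k, (qNat α k : ℂ) * z ^ k = ((3 / 2 : ℝ) ^ α : ℝ) *
      ∑ m ∈ Finset.range (k + 1),
        ((g α m : ℂ) * (z / 3) ^ m) * ((g α (k - m) : ℂ) * z ^ (k - m)) := fun k => by
    unfold qNat
    push_cast
    rw [mul_assoc, Finset.sum_mul]
    congr 1
    refine Finset.sum_congr rfl fun m hm => ?_
    have hmk : m ≤ k := Nat.lt_succ_iff.1 (Finset.mem_range.1 hm)
    rw [div_pow, ← pow_mul_pow_sub z hmk]
    ring
  constructor
  · simp_rw [hq, norm_mul]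
    exact (summable_norm_sum_mul_range_of_summable_norm hs3 hs).mul_left _
  · simp_rw [hq]
    rw [tsum_mul_left, ← tsum_mul_tsum_eq_tsum_sum_range_of_summable_norm hs3 hs,
      tsum_g_mul_pow h1 h2 hz, tsum_g_mul_pow h1 h2 hz3, symbol]

/-! ### Fourier coefficients and the quadratic form of a Toeplitz matrix -/

lemma integral_exp_int_mul_I (n : ℤ) :
    ∫ θ in (-Real.pi)..Real.pi, Complex.exp (n * θ * Complex.I) =
      if n = 0 then 2 * (Real.pi : ℂ) else 0 := by
  split_ifs with h
  · subst h; simp; ring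
  · have hc : (n : ℂ) * Complex.I ≠ 0 := mul_ne_zero (by exact_mod_cast h) Complex.I_ne_zero
    have := integral_exp_mul_complex (a := -Real.pi) (b := Real.pi) hc
    have e : ∀ θ : ℝ, (n : ℂ) * θ * Complex.I = n * Complex.I * θ := fun θ => by ring
    simp_rw [e]
    rw [this, div_eq_zero_iff]
    left
    rw [sub_eq_zero, Complex.exp_eq_exp_iff_exists_int]
    exact ⟨n, by push_cast; ring⟩

/-- Integrating the series termwise, dominated by Σ |q_k|, isolates the coefficient with index `m`;
for negative `m` no term survives, in accordance with the convention in `qInt`. -/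
lemma integral_symbol {α : ℝ} (h1 : 1 < α) (h2 : α < 2) (m : ℤ) :
    ∫ θ in (-Real.pi)..Real.pi,
      symbol α (Complex.exp (θ * Complex.I)) * Complex.exp (-(m * θ * Complex.I)) =
      2 * Real.pi * (qInt α m : ℂ) := by
  have hn : ∀ θ : ℝ, ‖Complex.exp (θ * Complex.I)‖ ≤ 1 := fun θ =>
    (Complex.norm_exp_ofReal_mul_I θ).le
  have hn' : ∀ θ : ℝ, ‖Complex.exp (-(m * θ * Complex.I))‖ = 1 := fun θ => by
    rw [show -(m * θ * Complex.I) = ((-(m * θ) : ℝ) : ℂ) * Complex.I by push_cast; ring]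
    exact Complex.norm_exp_ofReal_mul_I _
  have hsum : Summable fun k => |qNat α k| := by
    simpa using (hasSum_qNat h1 h2 (z := 1) (by simp)).1
  have H := intervalIntegral.hasSum_integral_of_dominated_convergence (μ := volume)
    (a := -Real.pi) (b := Real.pi)
    (F := fun (k : ℕ) (θ : ℝ) => (qNat α k : ℂ) * Complex.exp (θ * Complex.I) ^ k *
      Complex.exp (-(m * θ * Complex.I)))
    (f := fun θ : ℝ => symbol α (Complex.exp (θ * Complex.I)) *
      Complex.exp (-(m * θ * Complex.I)))
    (fun k _ => |qNat α k|)
    (fun k => (Continuous.aestronglyMeasurable (by fun_prop)))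
    (fun k => Filter.Eventually.of_forall fun θ _ => by
      rw [norm_mul, norm_mul, hn', mul_one, norm_pow, Complex.norm_real, Real.norm_eq_abs]
      exact mul_le_of_le_one_right (abs_nonneg _) (pow_le_one₀ (norm_nonneg _) (hn θ)))
    (Filter.Eventually.of_forall fun _ _ => hsum)
    (by simp)
    (Filter.Eventually.of_forall fun θ _ => by
      have := hasSum_qNat h1 h2 (hn θ)
      refine HasSum.mul_right _ ?_
      rw [← this.2]
      exact this.1.of_norm.hasSum)
  rw [← H.tsum_eq]
  have hk : ∀ k : ℕ, ∫ θ in (-Real.pi)..Real.pi, (qNat α k : ℂ) *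
      Complex.exp (θ * Complex.I) ^ k * Complex.exp (-(m * θ * Complex.I)) =
      (qNat α k : ℂ) * if (k : ℤ) - m = 0 then 2 * (Real.pi : ℂ) else 0 := fun k => by
    rw [← integral_exp_int_mul_I, ← intervalIntegral.integral_const_mul]
    refine intervalIntegral.integral_congr fun θ _ => ?_
    rw [mul_assoc, ← Complex.exp_nat_mul, ← Complex.exp_add]
    push_cast
    ring_nf
  simp_rw [hk]
  unfold qInt
  split_ifs with hm
  · have : ∀ k : ℕ, ¬ (k : ℤ) - m = 0 := fun k => by omega
    simp [this]
  · lift m to ℕ using by omega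
    rw [tsum_eq_single m]
    · simp; ring
    · intro k hkm
      rw [if_neg (by omega), mul_zero]

lemma continuous_symbol_exp {α : ℝ} (h1 : 1 < α) (h2 : α < 2) :
    Continuous fun θ : ℝ => symbol α (Complex.exp (θ * Complex.I)) := by
  have hsum : Summable fun k => |qNat α k| := by
    simpa using (hasSum_qNat h1 h2 (z := 1) (by simp)).1
  have e : (fun θ : ℝ => symbol α (Complex.exp (θ * Complex.I))) =
      fun θ : ℝ => ∑' k, (qNat α k : ℂ) * Complex.exp (θ * Complex.I) ^ k := by
    funext θ
    exact (hasSum_qNat h1 h2 (Complex.norm_exp_ofReal_mul_I θ).le).2.symm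
  rw [e]
  refine continuous_tsum (fun k => by fun_prop) hsum fun k θ => ?_
  rw [norm_mul, norm_pow, Complex.norm_real, Complex.norm_exp_ofReal_mul_I]
  simp

lemma symbol_conj {α : ℝ} (h1 : 1 < α) (h2 : α < 2) {z : ℂ} (hz : ‖z‖ ≤ 1) :
    symbol α ((starRingEnd ℂ) z) = (starRingEnd ℂ) (symbol α z) := by
  rw [← (hasSum_qNat h1 h2 hz).2, ← (hasSum_qNat h1 h2 (z := (starRingEnd ℂ) z) (by simpa using hz)).2,
    Complex.conj_tsum]
  simp

/-- The generating function `∑ c_k e^{-i p_k θ} (3/2 - 2e^{iθ} + e^{2iθ}/2)^α` of the Toeplitz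
matrix `∑ c_k A_{p_k}`. -/
noncomputable def genFun (α : ℝ) {N : ℕ} (c : Fin N → ℝ) (p : Fin N → ℤ) (θ : ℝ) : ℂ :=
  symbol α (Complex.exp (θ * Complex.I)) *
    ∑ k, (c k : ℂ) * Complex.exp (-(p k * θ * Complex.I))

lemma continuous_genFun {α : ℝ} (h1 : 1 < α) (h2 : α < 2) {N : ℕ} (c : Fin N → ℝ)
    (p : Fin N → ℤ) : Continuous (genFun α c p) :=
  (continuous_symbol_exp h1 h2).mul (by fun_prop)

lemma genFun_neg {α : ℝ} (h1 : 1 < α) (h2 : α < 2) {N : ℕ} (c : Fin N → ℝ)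
    (p : Fin N → ℤ) (θ : ℝ) : genFun α c p (-θ) = (starRingEnd ℂ) (genFun α c p θ) := by
  unfold genFun
  rw [map_mul, ← symbol_conj h1 h2 (Complex.norm_exp_ofReal_mul_I θ).le, map_sum]
  simp only [map_mul, ← Complex.exp_conj, map_neg, Complex.conj_ofReal, Complex.conj_I,
    Complex.ofReal_neg, map_intCast]
  congr 2
  · ring_nf
  · funext k
    ring_nf

/-- The endpoints 0 and π are reached by continuity, negative angles by conjugation. -/
lemma genFun_re_nonpos {α : ℝ} (h1 : 1 < α) (h2 : α < 2) {N : ℕ} (c : Fin N → ℝ)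
    (p : Fin N → ℤ) (H : ∀ θ ∈ Ioo 0 Real.pi, (genFun α c p θ).re < 0) :
    ∀ θ ∈ Icc (-Real.pi) Real.pi, (genFun α c p θ).re ≤ 0 := by
  have hc : Continuous fun θ => (genFun α c p θ).re :=
    Complex.continuous_re.comp (continuous_genFun h1 h2 c p)
  have key : ∀ θ ∈ Icc 0 Real.pi, (genFun α c p θ).re ≤ 0 := by
    intro θ hθ
    rw [← closure_Ioo Real.pi_pos.ne] at hθ
    exact le_on_closure (g := fun _ => (0 : ℝ)) (fun x hx => (H x hx).le) hc.continuousOn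
      continuousOn_const hθ
  intro θ hθ
  rcases le_total 0 θ with h | h
  · exact key θ ⟨h, hθ.2⟩
  · have := key (-θ) ⟨by linarith, by linarith [hθ.1]⟩
    rwa [genFun_neg h1 h2, Complex.conj_re] at this

/-- The trigonometric polynomial `∑ x_j e^{ijθ}`. -/
noncomputable def trigPoly {n : ℕ} (x : Fin n → ℝ) (θ : ℝ) : ℂ :=
  ∑ j, (x j : ℂ) * Complex.exp (j * θ * Complex.I)

lemma exists_trigPoly_ne_zero {n : ℕ} {x : Fin n → ℝ} (hx : x ≠ 0) :
    ∃ θ ∈ Ioo 0 Real.pi, trigPoly x θ ≠ 0 := by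
  by_contra! hcon
  let P : Polynomial ℂ := ∑ j : Fin n, Polynomial.monomial (j : ℕ) (x j : ℂ)
  have hP : P = 0 := by
    refine Polynomial.eq_zero_of_infinite_isRoot P ?_
    have hinj : InjOn (fun θ : ℝ => Complex.exp (θ * Complex.I)) (Ioo 0 Real.pi) := by
      intro a ha b hb hab
      have := congrArg Complex.re hab
      simp only [Complex.exp_ofReal_mul_I_re] at this
      exact Real.injOn_cos (Ioo_subset_Icc_self ha) (Ioo_subset_Icc_self hb) this
    refine ((Ioo_infinite Real.pi_pos).image hinj).mono ?_
    rintro _ ⟨θ, hθ, rfl⟩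
    have := hcon θ hθ
    simp only [mem_ofPred_eq, Polynomial.IsRoot.def]
    rw [← this]
    simp only [P, trigPoly, Polynomial.eval_finsetSum, Polynomial.eval_monomial]
    refine Finset.sum_congr rfl fun j _ => ?_
    rw [← Complex.exp_nat_mul]
    ring_nf
  apply hx
  funext j
  have := congrArg (fun Q => Polynomial.coeff Q (j : ℕ)) hP
  simp only [P, Polynomial.finsetSum_coeff, Polynomial.coeff_monomial, Polynomial.coeff_zero,
    Fin.val_inj] at this
  simpa using this

lemma trigPoly_normSq {n : ℕ} (x : Fin n → ℝ) (θ : ℝ) :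
    (Complex.normSq (trigPoly x θ) : ℂ) =
      ∑ i, ∑ j, (x i : ℂ) * x j * Complex.exp (-(((i : ℤ) - (j : ℤ) : ℤ) * θ * Complex.I)) := by
  rw [Complex.normSq_eq_conj_mul_self, trigPoly, map_sum, Finset.sum_mul_sum]
  refine Finset.sum_congr rfl fun i _ => Finset.sum_congr rfl fun j _ => ?_
  simp only [map_mul, ← Complex.exp_conj, Complex.conj_ofReal, Complex.conj_I, map_natCast]
  rw [mul_mul_mul_comm, ← Complex.exp_add]
  push_cast
  ring_nf

lemma integral_genFun_mul_normSq {α : ℝ} (h1 : 1 < α) (h2 : α < 2) {N n : ℕ} (c : Fin N → ℝ)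
    (p : Fin N → ℤ) (x : Fin n → ℝ) :
    ∫ θ in (-Real.pi)..Real.pi, genFun α c p θ * Complex.normSq (trigPoly x θ) =
      ((2 * Real.pi * (((∑ k, c k • A1 α n (p k)).mulVec x) ⬝ᵥ x) : ℝ) : ℂ) := by
  have hS := continuous_symbol_exp h1 h2
  have e : ∀ θ : ℝ, genFun α c p θ * Complex.normSq (trigPoly x θ) =
      ∑ k, ∑ i, ∑ j, ((c k : ℂ) * x i * x j) *
        (symbol α (Complex.exp (θ * Complex.I)) *
          Complex.exp (-((p k + (i : ℤ) - (j : ℤ) : ℤ) * θ * Complex.I))) := by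
    intro θ
    rw [trigPoly_normSq, genFun, mul_assoc, Finset.sum_mul_sum, Finset.mul_sum]
    simp only [Finset.mul_sum]
    refine Finset.sum_congr rfl fun k _ => Finset.sum_congr rfl fun i _ =>
      Finset.sum_congr rfl fun j _ => ?_
    have : Complex.exp (-((p k + (i : ℤ) - (j : ℤ) : ℤ) * θ * Complex.I)) =
        Complex.exp (-(p k * θ * Complex.I)) *
          Complex.exp (-(((i : ℤ) - (j : ℤ) : ℤ) * θ * Complex.I)) := by
      rw [← Complex.exp_add]; push_cast; ring_nf
    rw [this]; ring
  simp_rw [e]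
  rw [intervalIntegral.integral_finsetSum fun k _ => Continuous.intervalIntegrable (by fun_prop) _ _]
  have e2 : ∀ k, ∫ θ in (-Real.pi)..Real.pi, ∑ i : Fin n, ∑ j : Fin n, ((c k : ℂ) * x i * x j) *
        (symbol α (Complex.exp (θ * Complex.I)) *
          Complex.exp (-((p k + (i : ℤ) - (j : ℤ) : ℤ) * θ * Complex.I))) =
      ∑ i, ∑ j, ((c k : ℂ) * x i * x j) * (2 * Real.pi * qInt α (p k + (i : ℤ) - (j : ℤ))) := by
    intro k
    rw [intervalIntegral.integral_finsetSum
      fun i _ => Continuous.intervalIntegrable (by fun_prop) _ _]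
    refine Finset.sum_congr rfl fun i _ => ?_
    rw [intervalIntegral.integral_finsetSum
      fun j _ => Continuous.intervalIntegrable (by fun_prop) _ _]
    refine Finset.sum_congr rfl fun j _ => ?_
    rw [intervalIntegral.integral_const_mul, integral_symbol h1 h2]
  simp_rw [e2]
  have e3 : ((∑ k, c k • A1 α n (p k)).mulVec x) ⬝ᵥ x =
      ∑ k, ∑ i, ∑ j, c k * x i * x j * qInt α (p k + (i : ℤ) - (j : ℤ)) := by
    rw [Matrix.sum_mulVec, sum_dotProduct]
    refine Finset.sum_congr rfl fun k _ => ?_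
    rw [Matrix.smul_mulVec, smul_dotProduct, dotProduct, smul_eq_mul, Finset.mul_sum]
    refine Finset.sum_congr rfl fun i _ => ?_
    rw [Matrix.mulVec, dotProduct, Finset.sum_mul, Finset.mul_sum]
    refine Finset.sum_congr rfl fun j _ => ?_
    rw [A1, Matrix.of_apply]
    ring
  rw [e3]
  push_cast
  simp only [Finset.mul_sum]
  refine Finset.sum_congr rfl fun k _ => Finset.sum_congr rfl fun i _ =>
    Finset.sum_congr rfl fun j _ => by ring

/-- The form is an integral of a nonpositive continuous function, which is negative somewhere
because a nonzero trigonometric polynomial cannot vanish on all of (0, π). -/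
lemma isNegDef_of_genFun_re_neg {α : ℝ} (h1 : 1 < α) (h2 : α < 2) {N : ℕ} (n : ℕ)
    (c : Fin N → ℝ) (p : Fin N → ℤ) (H : ∀ θ ∈ Ioo 0 Real.pi, (genFun α c p θ).re < 0) :
    IsNegDef (∑ k, c k • A1 α n (p k)) := by
  intro x hx
  have hcg := continuous_genFun h1 h2 c p
  have hct : Continuous (trigPoly x) := by unfold trigPoly; fun_prop
  have hc : Continuous fun θ => (genFun α c p θ).re * Complex.normSq (trigPoly x θ) :=
    (Complex.continuous_re.comp hcg).mul (Complex.continuous_normSq.comp hct)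
  obtain ⟨θ₀, hθ₀, hne⟩ := exists_trigPoly_ne_zero hx
  have hlt : ∫ θ in (-Real.pi)..Real.pi, (genFun α c p θ).re * Complex.normSq (trigPoly x θ) <
      ∫ _ in (-Real.pi)..Real.pi, (0 : ℝ) := by
    refine intervalIntegral.integral_lt_integral_of_continuousOn_of_le_of_exists_lt
      (by linarith [Real.pi_pos]) hc.continuousOn continuousOn_const (fun θ hθ => ?_)
      ⟨θ₀, ⟨by linarith [Real.pi_pos, hθ₀.1], hθ₀.2.le⟩, ?_⟩
    · exact mul_nonpos_of_nonpos_of_nonneg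
        (genFun_re_nonpos h1 h2 c p H θ (Ioc_subset_Icc_self hθ)) (Complex.normSq_nonneg _)
    · exact mul_neg_of_neg_of_pos (H θ₀ hθ₀) (Complex.normSq_pos.2 hne)
  have hI := congrArg Complex.reCLM (integral_genFun_mul_normSq h1 h2 c p x)
  have hcf : Continuous fun θ => genFun α c p θ * (Complex.normSq (trigPoly x θ) : ℂ) :=
    hcg.mul (Complex.continuous_ofReal.comp (Complex.continuous_normSq.comp hct))
  rw [← ContinuousLinearMap.intervalIntegral_comp_comm _ (hcf.intervalIntegrable _ _)] at hI
  simp only [Complex.reCLM_apply, Complex.re_mul_ofReal, Complex.ofReal_re] at hI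
  rw [hI, intervalIntegral.integral_zero] at hlt
  have := Real.pi_pos
  by_contra hge
  push Not at hge
  exact absurd hlt (not_lt.2 (by positivity))

lemma IsNegDef.transpose {n : ℕ} {A : Matrix (Fin n) (Fin n) ℝ} (h : IsNegDef A) :
    IsNegDef A.transpose := by
  intro x hx
  have := h x hx
  rwa [Matrix.mulVec_transpose, ← Matrix.dotProduct_mulVec, dotProduct_comm]

/-- For an eigenvector x + iy one has (Ax, x) + (Ay, y) = Re z (|x|² + |y|²), since the terms with
Im z cancel. -/
lemma IsNegDef.eigenvaluesNegRe {n : ℕ} {A : Matrix (Fin n) (Fin n) ℝ} (h : IsNegDef A) :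
    EigenvaluesNegRe A := by
  intro z hz
  obtain ⟨v, hv⟩ := hz.exists_hasEigenvector
  have hv0 := hv.2
  have hvz := hv.apply_eq_smul
  rw [Matrix.toLin'_apply] at hvz
  set x : Fin n → ℝ := fun i => (v i).re
  set y : Fin n → ℝ := fun i => (v i).im
  have hre : ∀ i, A.mulVec x i = z.re * x i - z.im * y i := fun i => by
    have := congrArg Complex.re (congrFun hvz i)
    simpa [Matrix.mulVec, dotProduct, x, y] using this
  have him : ∀ i, A.mulVec y i = z.re * y i + z.im * x i := fun i => by
    have := congrArg Complex.im (congrFun hvz i)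
    simpa [Matrix.mulVec, dotProduct, x, y] using this
  have hsum : (A.mulVec x) ⬝ᵥ x + (A.mulVec y) ⬝ᵥ y = z.re * (x ⬝ᵥ x + y ⬝ᵥ y) := by
    simp only [dotProduct, hre, him, ← Finset.sum_add_distrib, Finset.mul_sum]
    exact Finset.sum_congr rfl fun i _ => by ring
  have hle : ∀ w : Fin n → ℝ, (A.mulVec w) ⬝ᵥ w ≤ 0 := fun w => by
    by_cases hw : w = 0
    · simp [hw]
    · exact (h w hw).le
  have hneg : (A.mulVec x) ⬝ᵥ x + (A.mulVec y) ⬝ᵥ y < 0 := by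
    by_cases hx : x = 0
    · have hy : y ≠ 0 := fun hy => hv0 (funext fun i =>
        Complex.ext (congrFun hx i) (congrFun hy i))
      linarith [hle x, h y hy]
    · linarith [hle y, h x hx]
  have hnn : ∀ w : Fin n → ℝ, 0 ≤ w ⬝ᵥ w := fun w =>
    Finset.sum_nonneg fun i _ => mul_self_nonneg _
  by_contra hz0
  push Not at hz0
  have := mul_nonneg hz0 (add_nonneg (hnn x) (hnn y))
  linarith

/-! ### Phase of the symbol on the unit circle -/

/-- The phase of the symbol on the unit circle: `ψ` is the phase angle belonging to `e^{iθ}`,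
where `s = sin (θ/2)` and `c = cos (θ/2)`. -/
structure IsPhase (s c ψ : ℝ) : Prop where
  s_pos : 0 < s
  c_pos : 0 < c
  sq_add_sq : s ^ 2 + c ^ 2 = 1
  pos : 0 < ψ
  lt : ψ < Real.pi / 2
  cos_eq : √(1 + 3 * s ^ 2) * Real.cos ψ = 2 * s ^ 3
  sin_eq : √(1 + 3 * s ^ 2) * Real.sin ψ = c * (1 + 2 * s ^ 2)

lemma neg_pi_div_two_lt_arg {w : ℂ} (hre : 0 < w.re) (him : w.im < 0) :
    -(Real.pi / 2) < w.arg ∧ w.arg < 0 :=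
  ⟨(abs_lt.1 (Complex.abs_arg_lt_pi_div_two_iff.2 (Or.inl hre))).1, Complex.arg_neg_iff.2 him⟩

lemma cpow_ofReal_eq {w : ℂ} (hw : w ≠ 0) (α : ℝ) :
    w ^ (α : ℂ) = (Real.exp (α * Real.log ‖w‖) : ℝ) * Complex.exp (α * w.arg * Complex.I) := by
  rw [Complex.cpow_def_of_ne_zero hw, Complex.ofReal_exp, ← Complex.exp_add, Complex.log]
  push_cast
  ring_nf

lemma exists_isPhase (α : ℝ) {θ : ℝ} (h0 : 0 < θ) (hπ : θ < Real.pi) :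
    ∃ R > 0, ∃ ψ, IsPhase (Real.sin (θ / 2)) (Real.cos (θ / 2)) ψ ∧
      symbol α (Complex.exp (θ * Complex.I)) = (R : ℝ) * Complex.exp (-(α * ψ * Complex.I)) := by
  set s := Real.sin (θ / 2)
  set c := Real.cos (θ / 2)
  have hs : 0 < s := Real.sin_pos_of_pos_of_lt_pi (by linarith) (by linarith)
  have hc : 0 < c := Real.cos_pos_of_mem_Ioo ⟨by linarith, by linarith⟩
  have hsc : s ^ 2 + c ^ 2 = 1 := Real.sin_sq_add_cos_sq _
  have hC : Real.cos θ = 1 - 2 * s ^ 2 := by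
    rw [show θ = 2 * (θ / 2) by ring, Real.cos_two_mul]; linarith
  have hS : Real.sin θ = 2 * s * c := by
    rw [show θ = 2 * (θ / 2) by ring, Real.sin_two_mul]
  set z := Complex.exp (θ * Complex.I)
  have hzr : z.re = 1 - 2 * s ^ 2 := by rw [← hC]; exact Complex.exp_ofReal_mul_I_re θ
  have hzi : z.im = 2 * s * c := by rw [← hS]; exact Complex.exp_ofReal_mul_I_im θ
  have hscp : 0 < s * c := mul_pos hs hc
  set w₁ : ℂ := 1 - z / 3
  set w₂ : ℂ := 1 - z
  have r1 : w₁.re = 1 - (1 - 2 * s ^ 2) / 3 := by simp [w₁, hzr]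
  have i1 : w₁.im = -(2 * s * c / 3) := by simp [w₁, hzi]
  have r2 : w₂.re = 2 * s ^ 2 := by simp [w₂, hzr]
  have i2 : w₂.im = -(2 * s * c) := by simp [w₂, hzi]
  have a1 := neg_pi_div_two_lt_arg (w := w₁) (by rw [r1]; nlinarith) (by rw [i1]; linarith)
  have a2 := neg_pi_div_two_lt_arg (w := w₂) (by rw [r2]; positivity) (by rw [i2]; linarith)
  have n1 : w₁ ≠ 0 := fun h => by rw [h] at a1; simp at a1
  have n2 : w₂ ≠ 0 := fun h => by rw [h] at a2; simp at a2
  -- Both factors lie in the open fourth quadrant, so ψ is in (0, π) and the two principal powers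
  -- share the single phase -αψ.
  set ψ := -(w₁.arg + w₂.arg)
  set ρ := √(1 + 3 * s ^ 2)
  have hρ : ρ ^ 2 = 1 + 3 * s ^ 2 := Real.sq_sqrt (by positivity)
  have hρ0 : 0 < ρ := Real.sqrt_pos.2 (by positivity)
  have hprod : w₁ * w₂ = (‖w₁‖ * ‖w₂‖ : ℝ) * Complex.exp ((-ψ : ℝ) * Complex.I) := by
    conv_lhs => rw [← Complex.norm_mul_exp_arg_mul_I w₁, ← Complex.norm_mul_exp_arg_mul_I w₂]
    rw [mul_mul_mul_comm, ← Complex.exp_add]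
    simp only [ψ]
    push_cast
    ring_nf
  -- In fact (3/2) w₁ w₂ = 2s (2s³ - i c(1 + 2s²)), which has modulus 2sρ.
  have hN : 3 / 2 * (‖w₁‖ * ‖w₂‖) = 2 * s * ρ := by
    have e1 : ‖w₁‖ ^ 2 = w₁.re * w₁.re + w₁.im * w₁.im := by
      rw [← Complex.normSq_eq_norm_sq, Complex.normSq_apply]
    have e2 : ‖w₂‖ ^ 2 = w₂.re * w₂.re + w₂.im * w₂.im := by
      rw [← Complex.normSq_eq_norm_sq, Complex.normSq_apply]
    rw [r1, i1] at e1
    rw [r2, i2] at e2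
    have f1 : ‖w₁‖ ^ 2 = 4 / 9 * (1 + 3 * s ^ 2) := by
      rw [e1]; linear_combination 4 / 9 * s ^ 2 * hsc
    have f2 : ‖w₂‖ ^ 2 = 4 * s ^ 2 := by
      rw [e2]; linear_combination 4 * s ^ 2 * hsc
    rw [← sq_eq_sq₀ (by positivity) (by positivity), mul_pow, mul_pow, f1, f2, mul_pow, hρ]
    ring
  have hre := congrArg Complex.re hprod
  have him := congrArg Complex.im hprod
  rw [Complex.re_ofReal_mul, Complex.exp_ofReal_mul_I_re, Complex.mul_re, r1, r2, i1, i2,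
    Real.cos_neg] at hre
  rw [Complex.im_ofReal_mul, Complex.exp_ofReal_mul_I_im, Complex.mul_im, r1, r2, i1, i2,
    Real.sin_neg] at him
  have hcos : ρ * Real.cos ψ = 2 * s ^ 3 := by
    have : 2 * s * (ρ * Real.cos ψ) = 2 * s * (2 * s ^ 3) := by
      linear_combination -(Real.cos ψ) * hN - 3 / 2 * hre - 2 * s^2 * hsc
    exact mul_left_cancel₀ (by positivity) this
  have hsin : ρ * Real.sin ψ = c * (1 + 2 * s ^ 2) := by
    have : 2 * s * (ρ * Real.sin ψ) = 2 * s * (c * (1 + 2 * s ^ 2)) := by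
      linear_combination -(Real.sin ψ) * hN + 3 / 2 * him
    exact mul_left_cancel₀ (by positivity) this
  refine ⟨(3 / 2 : ℝ) ^ α * (Real.exp (α * Real.log ‖w₁‖) * Real.exp (α * Real.log ‖w₂‖)),
    by positivity, ψ, ⟨hs, hc, hsc, by simp only [ψ]; linarith, ?_, hcos, hsin⟩, ?_⟩
  · by_contra hge
    push Not at hge
    have := Real.cos_nonpos_of_pi_div_two_le_of_le hge (by simp only [ψ]; linarith)
    have h2 : ρ * Real.cos ψ ≤ 0 := mul_nonpos_of_nonneg_of_nonpos hρ0.le this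
    rw [hcos] at h2
    have : 0 < 2 * s ^ 3 := by positivity
    linarith
  · rw [symbol, cpow_ofReal_eq n1, cpow_ofReal_eq n2, mul_mul_mul_comm _ _ _ (Complex.exp _),
      ← Complex.exp_add]
    simp only [ψ]
    push_cast
    ring_nf

lemma genFun_re_neg_of_phase {α : ℝ} {N : ℕ} (c : Fin N → ℝ) (p : Fin N → ℤ)
    (H : ∀ θ ψ, IsPhase (Real.sin (θ / 2)) (Real.cos (θ / 2)) ψ →
      ∑ k, c k * Real.cos (α * ψ + p k * θ) < 0) :
    ∀ θ ∈ Ioo 0 Real.pi, (genFun α c p θ).re < 0 := by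
  intro θ hθ
  obtain ⟨R, hR, ψ, hψ, e⟩ := exists_isPhase α hθ.1 hθ.2
  have : (genFun α c p θ).re = R * ∑ k, c k * Real.cos (α * ψ + p k * θ) := by
    rw [genFun, e, mul_assoc, Complex.re_ofReal_mul, Finset.mul_sum, Complex.re_sum]
    congr 1
    refine Finset.sum_congr rfl fun k _ => ?_
    rw [mul_left_comm, ← Complex.exp_add, Complex.re_ofReal_mul,
      show -(α * ψ * Complex.I) + -(p k * θ * Complex.I) =
        ((-(α * ψ + p k * θ) : ℝ) : ℂ) * Complex.I by push_cast; ring,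
      Complex.exp_ofReal_mul_I_re, Real.cos_neg]
  rw [this]
  exact mul_neg_of_pos_of_neg hR (H θ ψ hψ)

/-! ### Reduction of sinusoids at αψ to the values at ψ and 2ψ -/

lemma nonpos_of_pos_mul_nonpos {r t : ℝ} (hr : 0 < r) (h : r * t ≤ 0) : t ≤ 0 := by
  by_contra ht
  push Not at ht
  exact absurd (mul_pos hr ht) (not_lt.2 h)

lemma neg_of_pos_mul_neg {r t : ℝ} (hr : 0 < r) (h : r * t < 0) : t < 0 := by
  by_contra ht
  push Not at ht
  exact absurd (mul_nonneg hr.le ht) (not_le.2 h)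

/-- A sinusoid at `(1 + τ)ψ` is controlled by its values at `ψ` and `2ψ`. -/
lemma sinusoid_add_neg {ψ τ A B K : ℝ} (hψ0 : 0 < ψ) (hψ : ψ < Real.pi / 2) (hτ0 : 0 < τ)
    (hτ1 : τ < 1) (hf : A * Real.cos ψ - B * Real.sin ψ ≤ 0)
    (h1 : (1 - τ) * (A * Real.cos ψ - B * Real.sin ψ) +
      τ * (A * Real.cos (2 * ψ) - B * Real.sin (2 * ψ)) + K < 0)
    (h2 : (1 - τ) * (A * Real.cos ψ - B * Real.sin ψ) +
      τ * (11 / 7 * (A * Real.cos (2 * ψ) - B * Real.sin (2 * ψ))) + K < 0) :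
    A * Real.cos ((1 + τ) * ψ) - B * Real.sin ((1 + τ) * ψ) + K < 0 := by
  have hsin : 0 < Real.sin ψ := Real.sin_pos_of_pos_of_lt_pi hψ0 (by linarith)
  have hconc : ∀ t : ℝ, 0 ≤ t → t ≤ 1 → t * Real.sin ψ ≤ Real.sin (t * ψ) := fun t ht0 ht1 => by
    have h0 : (0 : ℝ) ∈ Icc 0 Real.pi := ⟨le_rfl, Real.pi_pos.le⟩
    have h1 : ψ ∈ Icc 0 Real.pi := ⟨hψ0.le, by linarith⟩
    simpa using strictConcaveOn_sin_Icc.concaveOn.2 h0 h1 (sub_nonneg.2 ht1) ht0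
      (sub_add_cancel 1 t)
  have hv1 := hconc τ hτ0.le hτ1.le
  have hu := hconc (1 - τ) (by linarith) (by linarith)
  -- The constant 11/7 is just above π/2, the constant in Jordan's inequality.
  have hv2 : Real.sin (τ * ψ) ≤ 11 / 7 * (τ * Real.sin ψ) := by
    have ha : Real.sin (τ * ψ) ≤ τ * ψ := Real.sin_le (by positivity)
    have hb := Real.mul_le_sin hψ0.le hψ.le
    have hpi := Real.pi_lt_d4
    have hc : ψ ≤ 11 / 7 * Real.sin ψ := by
      have : 2 / Real.pi * ψ * Real.pi = 2 * ψ := by field_simp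
      nlinarith [Real.pi_pos]
    nlinarith
  set F := A * Real.cos ψ - B * Real.sin ψ with hF
  set G := A * Real.cos (2 * ψ) - B * Real.sin (2 * ψ) with hG
  have key : Real.sin ψ * (A * Real.cos ((1 + τ) * ψ) - B * Real.sin ((1 + τ) * ψ)) =
      Real.sin ((1 - τ) * ψ) * F + Real.sin (τ * ψ) * G := by
    have e1 : (1 - τ) * ψ = ψ - τ * ψ := by ring
    have e2 : (1 + τ) * ψ = ψ + τ * ψ := by ring
    rw [hF, hG, e1, e2, Real.sin_sub, Real.cos_add, Real.sin_add, Real.cos_two_mul,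
      Real.sin_two_mul]
    linear_combination (A * Real.sin (τ * ψ) * (-1)) * (Real.sin_sq_add_cos_sq ψ)
  refine neg_of_pos_mul_neg hsin ?_
  rw [mul_add, key]
  have hFu : Real.sin ((1 - τ) * ψ) * F ≤ (1 - τ) * Real.sin ψ * F :=
    mul_le_mul_of_nonpos_right hu hf
  -- The sign of G decides which bound on sin(τψ) is the unfavourable one: the lower bound leads to
  -- `h1`, the upper to `h2`.
  rcases le_total G 0 with hg | hg
  · have := mul_le_mul_of_nonpos_right hv1 hg
    have := mul_neg_of_pos_of_neg hsin h1
    linarith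
  · have := mul_le_mul_of_nonneg_right hv2 hg
    have := mul_neg_of_pos_of_neg hsin h2
    linarith

/-- For coefficients depending affinely on `α ∈ (1, 2)` it is enough to have inequalities for
`α = 1` and `α = 2`. -/
lemma sinusoid_affine_neg {ψ α A₁ A₂ B₁ B₂ K₁ K₂ : ℝ} (hψ0 : 0 < ψ) (hψ : ψ < Real.pi / 2)
    (h1 : 1 < α) (h2 : α < 2)
    (f₁ : A₁ * Real.cos ψ - B₁ * Real.sin ψ ≤ 0) (f₂ : A₂ * Real.cos ψ - B₂ * Real.sin ψ ≤ 0)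
    (fK : A₁ * Real.cos ψ - B₁ * Real.sin ψ + K₁ ≤ 0)
    (g₂ : A₂ * Real.cos (2 * ψ) - B₂ * Real.sin (2 * ψ) ≤ 0)
    (gK : A₂ * Real.cos (2 * ψ) - B₂ * Real.sin (2 * ψ) + K₂ ≤ 0)
    (fg : A₂ * Real.cos ψ - B₂ * Real.sin ψ +
      (A₁ * Real.cos (2 * ψ) - B₁ * Real.sin (2 * ψ)) + K₁ + K₂ < 0)
    (fg' : A₂ * Real.cos ψ - B₂ * Real.sin ψ +
      11 / 7 * (A₁ * Real.cos (2 * ψ) - B₁ * Real.sin (2 * ψ)) + K₁ + K₂ < 0) :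
    ((2 - α) * A₁ + (α - 1) * A₂) * Real.cos (α * ψ) -
      ((2 - α) * B₁ + (α - 1) * B₂) * Real.sin (α * ψ) +
      ((2 - α) * K₁ + (α - 1) * K₂) < 0 := by
  have hp : 0 < 2 - α := by linarith
  have hq : 0 < α - 1 := by linarith
  have hpq := mul_pos hp hq
  have := sinusoid_add_neg (τ := α - 1) (A := (2 - α) * A₁ + (α - 1) * A₂)
    (B := (2 - α) * B₁ + (α - 1) * B₂) (K := (2 - α) * K₁ + (α - 1) * K₂) hψ0 hψ hq (by linarith)
    ?_ ?_ ?_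
  · rwa [show 1 + (α - 1) = α by ring] at this
  · linarith [mul_nonpos_of_nonneg_of_nonpos hp.le f₁, mul_nonpos_of_nonneg_of_nonpos hq.le f₂]
  -- With (2 - α) + (α - 1) = 1 the goal is a quadratic form in the two weights; its three
  -- coefficients are the left sides of `fK`, `fg`, `gK`.
  · have m1 := mul_nonpos_of_nonneg_of_nonpos (mul_pos hp hp).le fK
    have m2 := mul_neg_of_pos_of_neg hpq fg
    have m3 := mul_nonpos_of_nonneg_of_nonpos (mul_pos hq hq).le gK
    linarith
  · have m1 := mul_nonpos_of_nonneg_of_nonpos (mul_pos hp hp).le fK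
    have m2 := mul_neg_of_pos_of_neg hpq fg'
    have m3 := mul_nonpos_of_nonneg_of_nonpos (mul_pos hq hq).le gK
    have m4 := mul_nonpos_of_nonneg_of_nonpos (mul_pos hq hq).le g₂
    linarith

/-! ### Inequalities for the phase, at α = 1 and α = 2 -/

namespace IsPhase

variable {s c ψ : ℝ}

lemma s_lt_one (h : IsPhase s c ψ) : s < 1 := by
  nlinarith [h.sq_add_sq, h.c_pos, h.s_pos]

lemma sqrt_pos : 0 < √(1 + 3 * s ^ 2) := Real.sqrt_pos.2 (by positivity)

lemma sqrt_sq : √(1 + 3 * s ^ 2) ^ 2 = 1 + 3 * s ^ 2 := Real.sq_sqrt (by positivity)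

/-- All sine coefficients below carry the factor s³c. It turns the c in sin ψ into c² = 1 - s², so
that apart from s³ only a polynomial in s² is left. -/
lemma sqrt_mul_eq (h : IsPhase s c ψ) (A b : ℝ) :
    √(1 + 3 * s ^ 2) * (A * Real.cos ψ - s ^ 3 * c * b * Real.sin ψ) =
      s ^ 3 * (2 * A - b * ((1 - s ^ 2) * (1 + 2 * s ^ 2))) := by
  linear_combination A * h.cos_eq - s ^ 3 * c * b * h.sin_eq -
    s ^ 3 * b * (1 + 2 * s ^ 2) * h.sq_add_sq

/-- At the double angle the square root disappears and only even powers of s occur. -/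
lemma mul_eq (h : IsPhase s c ψ) (A b : ℝ) :
    (1 + 3 * s ^ 2) * (A * Real.cos (2 * ψ) - s ^ 3 * c * b * Real.sin (2 * ψ)) =
      A * (8 * s ^ 6 - 3 * s ^ 2 - 1) - 4 * b * s ^ 6 * ((1 - s ^ 2) * (1 + 2 * s ^ 2)) := by
  have e1 : (1 + 3 * s ^ 2) * Real.cos ψ ^ 2 = 4 * s ^ 6 := by
    rw [← sqrt_sq, ← mul_pow, h.cos_eq]; ring
  have e2 : (1 + 3 * s ^ 2) * (Real.sin ψ * Real.cos ψ) = 2 * s ^ 3 * (c * (1 + 2 * s ^ 2)) := by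
    rw [← sqrt_sq, ← h.cos_eq, ← h.sin_eq]; ring
  rw [Real.cos_two_mul, Real.sin_two_mul]
  linear_combination 2 * A * e1 - 2 * s ^ 3 * c * b * e2 -
    4 * s ^ 6 * b * (1 + 2 * s ^ 2) * h.sq_add_sq

lemma nonpos_of_poly (h : IsPhase s c ψ) {A b : ℝ}
    (hφ : 2 * A - b * ((1 - s ^ 2) * (1 + 2 * s ^ 2)) ≤ 0) :
    A * Real.cos ψ - s ^ 3 * c * b * Real.sin ψ ≤ 0 := by
  refine nonpos_of_pos_mul_nonpos (r := √(1 + 3 * s ^ 2)) sqrt_pos ?_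
  rw [h.sqrt_mul_eq]
  exact mul_nonpos_of_nonneg_of_nonpos (pow_nonneg h.s_pos.le _) hφ

/-- Since the polynomial factor is nonpositive, √(1 + 3s²) and s³ may be replaced by the smaller 1 +
s² and s⁴, which leaves a polynomial in s². -/
lemma mul_le_of_poly (h : IsPhase s c ψ) {A b : ℝ}
    (hφ : 2 * A - b * ((1 - s ^ 2) * (1 + 2 * s ^ 2)) ≤ 0) :
    (1 + 3 * s ^ 2) * (A * Real.cos ψ - s ^ 3 * c * b * Real.sin ψ) ≤
      (1 + s ^ 2) * (s ^ 2) ^ 2 * (2 * A - b * ((1 - s ^ 2) * (1 + 2 * s ^ 2))) := by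
  have hs := h.s_pos
  have hs1 := h.s_lt_one
  have hρ : 1 + s ^ 2 ≤ √(1 + 3 * s ^ 2) := by
    refine Real.le_sqrt_of_sq_le ?_
    nlinarith [mul_nonneg (sq_nonneg s) (sub_nonneg.2 hs1.le), mul_pos hs hs]
  have e : (1 + 3 * s ^ 2) * (A * Real.cos ψ - s ^ 3 * c * b * Real.sin ψ) =
      √(1 + 3 * s ^ 2) * s ^ 3 * (2 * A - b * ((1 - s ^ 2) * (1 + 2 * s ^ 2))) := by
    rw [mul_assoc (√(1 + 3 * s ^ 2)), ← h.sqrt_mul_eq, ← mul_assoc, ← sq, sqrt_sq]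
  rw [e]
  refine mul_le_mul_of_nonpos_right ?_ hφ
  refine mul_le_mul hρ ?_ (by positivity) sqrt_pos.le
  nlinarith [mul_nonneg (pow_nonneg hs.le 3) (sub_nonneg.2 hs1.le)]

/-- Third order part plus the worst case of a third divided difference, for small angles. -/
lemma third_order_neg_of_le (h : IsPhase s c ψ) {α : ℝ} (h1 : 1 < α) (h2 : α < 2)
    (hx : s ^ 2 ≤ 11 / 20) :
    ((2 - α) * ((9 - 12 * s ^ 2 - 8 * (s ^ 2) ^ 2) / 9) +
        (α - 1) * ((9 - 24 * s ^ 2 + 8 * (s ^ 2) ^ 2) / 9)) * Real.cos (α * ψ) -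
      ((2 - α) * (s ^ 3 * c * (40 / 9)) + (α - 1) * (s ^ 3 * c * (32 / 9))) *
        Real.sin (α * ψ) +
      ((2 - α) * (22 / 9 * s ^ 3) + (α - 1) * (4 / 9 * s ^ 3)) < 0 := by
  have hs := h.s_pos
  have hs1 := h.s_lt_one
  have hx0 : 0 < s ^ 2 := by positivity
  have e6 : s ^ 6 = (s ^ 2) ^ 3 := by ring
  have hsx : s ^ 3 ≤ s ^ 2 := pow_le_pow_of_le_one hs.le hs1.le (by norm_num)
  have hs3 : 0 < s ^ 3 := by positivity
  have F1 := h.sqrt_mul_eq ((9 - 12 * s ^ 2 - 8 * (s ^ 2) ^ 2) / 9) (40 / 9)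
  have F2 := h.sqrt_mul_eq ((9 - 24 * s ^ 2 + 8 * (s ^ 2) ^ 2) / 9) (32 / 9)
  have G1 := h.mul_eq ((9 - 12 * s ^ 2 - 8 * (s ^ 2) ^ 2) / 9) (40 / 9)
  have G2 := h.mul_eq ((9 - 24 * s ^ 2 + 8 * (s ^ 2) ^ 2) / 9) (32 / 9)
  rw [e6] at G1 G2
  have hρ := sqrt_pos (s := s)
  set x := s ^ 2
  set ρ := √(1 + 3 * x)
  have hv : 0 ≤ 11 / 20 - x := by linarith
  -- Bernstein products for [0, 11/20]: each polynomial inequality that cites them follows from a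
  -- nonnegative combination of them.
  have B : ∀ i j : ℕ, 0 ≤ x ^ i * (11 / 20 - x) ^ j := fun i j =>
    mul_nonneg (pow_nonneg hx0.le i) (pow_nonneg hv j)
  have hR : 0 < 1 + 3 * x := by positivity
  -- Multiplied by ρ and divided by s³/9, `fK` reads 22ρ ≤ 22 + 64x(1 - x).
  have hρ1 : ρ ≤ 1 + 32 / 11 * (x * (1 - x)) := by
    refine Real.sqrt_le_iff.2 ⟨by nlinarith, ?_⟩
    have : 0 ≤ x * (1364 - 2816 * x + 4096 * (x * (1 - x) ^ 2)) := by
      refine mul_nonneg hx0.le ?_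
      linarith [B 0 4, B 1 3, B 2 2, B 3 1, B 4 0]
    linarith
  have hρ2 : ρ ≤ 2 := Real.sqrt_le_iff.2 ⟨by norm_num, by linarith⟩
  have fK : (9 - 12 * x - 8 * x ^ 2) / 9 * Real.cos ψ - s ^ 3 * c * (40 / 9) * Real.sin ψ +
      22 / 9 * s ^ 3 ≤ 0 := by
    refine nonpos_of_pos_mul_nonpos hρ ?_
    rw [mul_add, F1]
    have := mul_nonneg hs3.le (sub_nonneg.2 hρ1)
    linarith
  have f₂ : (9 - 24 * x + 8 * x ^ 2) / 9 * Real.cos ψ - s ^ 3 * c * (32 / 9) * Real.sin ψ ≤ 0 :=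
    h.nonpos_of_poly (by nlinarith)
  have gK : (9 - 24 * x + 8 * x ^ 2) / 9 * Real.cos (2 * ψ) -
      s ^ 3 * c * (32 / 9) * Real.sin (2 * ψ) + 4 / 9 * s ^ 3 ≤ 0 := by
    refine nonpos_of_pos_mul_nonpos hR ?_
    rw [mul_add, G2]
    have := mul_le_mul_of_nonneg_left hsx hR.le
    linarith [B 0 5, B 1 4, B 2 3, B 3 2, B 4 1, B 5 0]
  have g₁ : (9 - 12 * x - 8 * x ^ 2) / 9 * Real.cos (2 * ψ) -
      s ^ 3 * c * (40 / 9) * Real.sin (2 * ψ) ≤ 0 := by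
    refine nonpos_of_pos_mul_nonpos hR ?_
    rw [G1]
    linarith [B 0 5, B 1 4, B 2 3, B 3 2, B 4 1, B 5 0]
  have fg : (9 - 24 * x + 8 * x ^ 2) / 9 * Real.cos ψ - s ^ 3 * c * (32 / 9) * Real.sin ψ +
      ((9 - 12 * x - 8 * x ^ 2) / 9 * Real.cos (2 * ψ) -
        s ^ 3 * c * (40 / 9) * Real.sin (2 * ψ)) + 22 / 9 * s ^ 3 + 4 / 9 * s ^ 3 < 0 := by
    have a1 := mul_le_mul_of_nonpos_right hρ2 f₂
    rw [F2] at a1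
    have a2 : s ^ 3 * ((19 - 40 * x + 40 * x ^ 2) / 9) ≤ x * ((19 - 40 * x + 40 * x ^ 2) / 9) :=
      mul_le_mul_of_nonneg_right hsx (by nlinarith [sq_nonneg (2 * x - 1)])
    have a3 : (9 - 12 * x - 8 * x ^ 2) / 9 * Real.cos (2 * ψ) -
        s ^ 3 * c * (40 / 9) * Real.sin (2 * ψ) + x * ((19 - 40 * x + 40 * x ^ 2) / 9) < 0 := by
      refine neg_of_pos_mul_neg hR ?_
      rw [mul_add, G1]
      linarith [B 0 5, B 1 4, B 2 3, B 3 2, B 4 1, B 5 0]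
    linarith
  refine sinusoid_affine_neg h.pos h.lt h1 h2 (by linarith) f₂ fK (by linarith) gK fg ?_
  linarith

/-- Third order part plus `8/15` times the modulus of the remaining weight, for large angles. -/
lemma third_order_neg_of_ge (h : IsPhase s c ψ) {α : ℝ} (h1 : 1 < α) (h2 : α < 2)
    (hx : 11 / 20 ≤ s ^ 2) :
    ((2 - α) * ((9 - 12 * s ^ 2 - 8 * (s ^ 2) ^ 2) / 9) +
        (α - 1) * ((9 - 24 * s ^ 2 + 8 * (s ^ 2) ^ 2) / 9)) * Real.cos (α * ψ) -
      ((2 - α) * (s ^ 3 * c * (40 / 9)) + (α - 1) * (s ^ 3 * c * (32 / 9))) *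
        Real.sin (α * ψ) +
      ((2 - α) * (44 / 45) + (α - 1) * (8 / 45)) < 0 := by
  have hs := h.s_pos
  have hs1 := h.s_lt_one
  have e6 : s ^ 6 = (s ^ 2) ^ 3 := by ring
  have hs3 : 0 < s ^ 3 := by positivity
  have hx1 : s ^ 2 < 1 := by nlinarith
  have F1 := h.sqrt_mul_eq ((9 - 12 * s ^ 2 - 8 * (s ^ 2) ^ 2) / 9) (40 / 9)
  have G1 := h.mul_eq ((9 - 12 * s ^ 2 - 8 * (s ^ 2) ^ 2) / 9) (40 / 9)
  have G2 := h.mul_eq ((9 - 24 * s ^ 2 + 8 * (s ^ 2) ^ 2) / 9) (32 / 9)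
  have H2 := h.mul_le_of_poly (A := (9 - 24 * s ^ 2 + 8 * (s ^ 2) ^ 2) / 9) (b := 32 / 9)
    (by nlinarith)
  rw [e6] at G1 G2
  have hρ := sqrt_pos (s := s)
  set x := s ^ 2
  set ρ := √(1 + 3 * x)
  have hw : 0 ≤ x - 11 / 20 := by linarith
  have hv : 0 ≤ 1 - x := by linarith
  have B : ∀ i j : ℕ, 0 ≤ (x - 11 / 20) ^ i * (1 - x) ^ j := fun i j =>
    mul_nonneg (pow_nonneg hw i) (pow_nonneg hv j)
  have hR : 0 < 1 + 3 * x := by linarith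
  -- This is `fK` multiplied by 9ρ.
  have hρ1 : 44 / 5 * ρ ≤ s ^ 3 * (22 + 64 * (x * (1 - x))) := by
    have hm : 0 ≤ x * (1 - x) := mul_nonneg (by linarith) hv
    have e : 44 / 5 * ρ = √((44 / 5) ^ 2 * (1 + 3 * x)) := by
      rw [Real.sqrt_mul (by positivity), Real.sqrt_sq (by norm_num)]
    rw [e]
    refine Real.sqrt_le_iff.2 ⟨mul_nonneg hs3.le (by linarith), ?_⟩
    rw [mul_pow, ← pow_mul, e6]
    linarith [B 0 7, B 1 6, B 2 5, B 3 4, B 4 3, B 5 2, B 6 1, B 7 0]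
  have fK : (9 - 12 * x - 8 * x ^ 2) / 9 * Real.cos ψ - s ^ 3 * c * (40 / 9) * Real.sin ψ +
      44 / 45 ≤ 0 := by
    refine nonpos_of_pos_mul_nonpos hρ ?_
    rw [mul_add, F1]
    linarith
  have gK : (9 - 24 * x + 8 * x ^ 2) / 9 * Real.cos (2 * ψ) -
      s ^ 3 * c * (32 / 9) * Real.sin (2 * ψ) + 8 / 45 ≤ 0 := by
    refine nonpos_of_pos_mul_nonpos hR ?_
    rw [mul_add, G2]
    linarith [B 0 5, B 1 4, B 2 3, B 3 2, B 4 1, B 5 0]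
  have g₁ : (9 - 12 * x - 8 * x ^ 2) / 9 * Real.cos (2 * ψ) -
      s ^ 3 * c * (40 / 9) * Real.sin (2 * ψ) ≤ 0 := by
    refine nonpos_of_pos_mul_nonpos hR ?_
    rw [G1]
    linarith [B 0 5, B 1 4, B 2 3, B 3 2, B 4 1, B 5 0]
  have fg : (9 - 24 * x + 8 * x ^ 2) / 9 * Real.cos ψ - s ^ 3 * c * (32 / 9) * Real.sin ψ +
      ((9 - 12 * x - 8 * x ^ 2) / 9 * Real.cos (2 * ψ) -
        s ^ 3 * c * (40 / 9) * Real.sin (2 * ψ)) + 44 / 45 + 8 / 45 < 0 := by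
    refine neg_of_pos_mul_neg hR ?_
    rw [mul_add, mul_add, mul_add, G1]
    linarith [B 0 5, B 1 4, B 2 3, B 3 2, B 4 1, B 5 0]
  refine sinusoid_affine_neg h.pos h.lt h1 h2 (by linarith)
    (h.nonpos_of_poly (by nlinarith)) fK (by linarith) gK fg ?_
  linarith

/-- The terms 11/9 s⁴ and 1/9 s⁴ are 2/3 s⁴ times the upper bound for `lam` in `fourth_order_neg` at
α = 1 and α = 2. -/
lemma fourth_order_neg_upper (h : IsPhase s c ψ) {α : ℝ} (h1 : 1 < α) (h2 : α < 2) :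
    ((2 - α) * ((9 - 12 * s ^ 2 - 8 * (s ^ 2) ^ 2) / 9 + 11 / 9 * (s ^ 2) ^ 2) +
        (α - 1) * ((9 - 24 * s ^ 2 + 8 * (s ^ 2) ^ 2) / 9 + 1 / 9 * (s ^ 2) ^ 2)) *
        Real.cos (α * ψ) -
      ((2 - α) * (s ^ 3 * c * 2) + (α - 1) * (s ^ 3 * c * 4)) * Real.sin (α * ψ) < 0 := by
  have hs := h.s_pos
  have hs1 := h.s_lt_one
  have hx0 : 0 < s ^ 2 := by positivity
  have hx1 : s ^ 2 < 1 := by nlinarith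
  have e6 : s ^ 6 = (s ^ 2) ^ 3 := by ring
  have G1 := h.mul_eq ((9 - 12 * s ^ 2 - 8 * (s ^ 2) ^ 2) / 9 + 11 / 9 * (s ^ 2) ^ 2) 2
  have G2 := h.mul_eq ((9 - 24 * s ^ 2 + 8 * (s ^ 2) ^ 2) / 9 + 1 / 9 * (s ^ 2) ^ 2) 4
  have H2 := h.mul_le_of_poly (A := (9 - 24 * s ^ 2 + 8 * (s ^ 2) ^ 2) / 9 + 1 / 9 * (s ^ 2) ^ 2)
    (b := 4) (by nlinarith)
  rw [e6] at G1 G2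
  set x := s ^ 2
  have hv : 0 ≤ 1 - x := by linarith
  have B : ∀ i j : ℕ, 0 ≤ x ^ i * (1 - x) ^ j := fun i j =>
    mul_nonneg (pow_nonneg hx0.le i) (pow_nonneg hv j)
  have hR : 0 < 1 + 3 * x := by positivity
  have g₁ : ((9 - 12 * x - 8 * x ^ 2) / 9 + 11 / 9 * x ^ 2) * Real.cos (2 * ψ) -
      s ^ 3 * c * 2 * Real.sin (2 * ψ) ≤ 0 := by
    refine nonpos_of_pos_mul_nonpos hR ?_
    rw [G1]
    linarith [B 0 5, B 1 4, B 2 3, B 3 2, B 4 1, B 5 0]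
  have g₂ : ((9 - 24 * x + 8 * x ^ 2) / 9 + 1 / 9 * x ^ 2) * Real.cos (2 * ψ) -
      s ^ 3 * c * 4 * Real.sin (2 * ψ) ≤ 0 := by
    refine nonpos_of_pos_mul_nonpos hR ?_
    rw [G2]
    linarith [B 0 5, B 1 4, B 2 3, B 3 2, B 4 1, B 5 0]
  have f₂ : ((9 - 24 * x + 8 * x ^ 2) / 9 + 1 / 9 * x ^ 2) * Real.cos ψ -
      s ^ 3 * c * 4 * Real.sin ψ < 0 := by
    refine neg_of_pos_mul_neg hR (H2.trans_lt ?_)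
    exact mul_neg_of_pos_of_neg (by positivity) (by nlinarith)
  have f₁ : ((9 - 12 * x - 8 * x ^ 2) / 9 + 11 / 9 * x ^ 2) * Real.cos ψ -
      s ^ 3 * c * 2 * Real.sin ψ ≤ 0 := h.nonpos_of_poly (by nlinarith [mul_nonneg hx0.le hv])
  have := sinusoid_affine_neg (K₁ := 0) (K₂ := 0) h.pos h.lt h1 h2 f₁ f₂.le (by linarith) g₂
    (by linarith) (by linarith) (by linarith)
  linarith

/-- Here -52/9 and -20/9 come from the lower bound for `lam`. The α = 1 sinusoid can be positive at
2ψ, so the inequality with 11/7 is the decisive one. -/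
lemma fourth_order_neg_lower (h : IsPhase s c ψ) {α : ℝ} (h1 : 1 < α) (h2 : α < 2) :
    ((2 - α) * ((9 - 12 * s ^ 2 - 8 * (s ^ 2) ^ 2) / 9 - 52 / 9 * (s ^ 2) ^ 2) +
        (α - 1) * ((9 - 24 * s ^ 2 + 8 * (s ^ 2) ^ 2) / 9 - 20 / 9 * (s ^ 2) ^ 2)) *
        Real.cos (α * ψ) -
      ((2 - α) * (s ^ 3 * c * 2) + (α - 1) * (s ^ 3 * c * 4)) * Real.sin (α * ψ) < 0 := by
  have hs := h.s_pos
  have hs1 := h.s_lt_one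
  have hx0 : 0 < s ^ 2 := by positivity
  have hx1 : s ^ 2 < 1 := by nlinarith
  have e6 : s ^ 6 = (s ^ 2) ^ 3 := by ring
  have G1 := h.mul_eq ((9 - 12 * s ^ 2 - 8 * (s ^ 2) ^ 2) / 9 - 52 / 9 * (s ^ 2) ^ 2) 2
  have G2 := h.mul_eq ((9 - 24 * s ^ 2 + 8 * (s ^ 2) ^ 2) / 9 - 20 / 9 * (s ^ 2) ^ 2) 4
  have hφ : 2 * ((9 - 24 * s ^ 2 + 8 * (s ^ 2) ^ 2) / 9 - 20 / 9 * (s ^ 2) ^ 2) -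
      4 * ((1 - s ^ 2) * (1 + 2 * s ^ 2)) ≤ 0 := by nlinarith
  have f₂ := h.nonpos_of_poly hφ
  have H2 := h.mul_le_of_poly hφ
  rw [e6] at G1 G2
  set x := s ^ 2
  have hv : 0 ≤ 1 - x := by linarith
  have hR : 0 < 1 + 3 * x := by positivity
  have B : ∀ i j : ℕ, 0 ≤ x ^ i * (1 - x) ^ j := fun i j =>
    mul_nonneg (pow_nonneg hx0.le i) (pow_nonneg hv j)
  have g₂ : ((9 - 24 * x + 8 * x ^ 2) / 9 - 20 / 9 * x ^ 2) * Real.cos (2 * ψ) -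
      s ^ 3 * c * 4 * Real.sin (2 * ψ) ≤ 0 := by
    refine nonpos_of_pos_mul_nonpos hR ?_
    rw [G2]
    linarith [B 0 9, B 1 8, B 2 7, B 3 6, B 4 5, B 5 4, B 6 3, B 7 2, B 8 1, B 9 0]
  have f₁ : ((9 - 12 * x - 8 * x ^ 2) / 9 - 52 / 9 * x ^ 2) * Real.cos ψ -
      s ^ 3 * c * 2 * Real.sin ψ ≤ 0 := h.nonpos_of_poly (by nlinarith)
  have fg' : ((9 - 24 * x + 8 * x ^ 2) / 9 - 20 / 9 * x ^ 2) * Real.cos ψ -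
      s ^ 3 * c * 4 * Real.sin ψ +
      11 / 7 * (((9 - 12 * x - 8 * x ^ 2) / 9 - 52 / 9 * x ^ 2) * Real.cos (2 * ψ) -
      s ^ 3 * c * 2 * Real.sin (2 * ψ)) < 0 := by
    refine neg_of_pos_mul_neg hR ?_
    rw [mul_add, mul_left_comm, G1]
    rcases le_total x (9 / 20) with hx | hx
    · have hv : 0 ≤ 9 / 20 - x := by linarith
      have B : ∀ i j : ℕ, 0 ≤ x ^ i * (9 / 20 - x) ^ j := fun i j =>
        mul_nonneg (pow_nonneg hx0.le i) (pow_nonneg hv j)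
      linarith [B 0 5, B 1 4, B 2 3, B 3 2, B 4 1, B 5 0]
    · have hw : 0 ≤ x - 9 / 20 := by linarith
      have B : ∀ i j : ℕ, 0 ≤ (x - 9 / 20) ^ i * (1 - x) ^ j := fun i j =>
        mul_nonneg (pow_nonneg hw i) (pow_nonneg hv j)
      linarith [B 0 5, B 1 4, B 2 3, B 3 2, B 4 1, B 5 0]
  have := sinusoid_affine_neg (K₁ := 0) (K₂ := 0) h.pos h.lt h1 h2 f₁ f₂ (by linarith) g₂
    (by linarith) (by linarith) (by linarith)
  linarith

end IsPhase

/-! ### Interpolation errors and third divided differences -/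

/-- The error at `m` of the quadratic interpolation of `T` at the nodes `1, 2, -2`. -/
noncomputable def interpErr (T : ℤ → ℝ) (m : ℤ) : ℝ :=
  T m + ((m : ℝ) - 2) * (m + 2) / 3 * T 1 - ((m : ℝ) - 1) * (m + 2) / 4 * T 2 -
    ((m : ℝ) - 1) * (m - 2) / 12 * T (-2)

/-- Such an e has the signs of the cubic (m - 1)(m - 2)(m + 2) with the same zeros; the signs of e
and of its first and second differences propagate outwards together. -/
lemma sign_of_third_diff_nonneg {e : ℤ → ℝ}
    (h : ∀ j, 0 ≤ e (j + 3) - 3 * e (j + 2) + 3 * e (j + 1) - e j)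
    (h1 : e 1 = 0) (h2 : e 2 = 0) (h3 : e (-2) = 0) :
    (∀ m, 2 ≤ m → 0 ≤ e m) ∧ ∀ m, m ≤ -2 → e m ≤ 0 := by
  -- These two instances give e(0) ≤ e(-1) ≤ 3e(0), hence the signs that start both inductions.
  have a2 := h (-2)
  have a1 := h (-1)
  norm_num [h1, h2, h3] at a1 a2
  constructor
  · have key : ∀ k : ℕ, 0 ≤ e (k + 2) ∧ 0 ≤ e (k + 2) - e (k + 1) ∧
        0 ≤ e (k + 2) - 2 * e (k + 1) + e k := by
      intro k
      induction k with
      | zero => norm_num [h1, h2]; linarith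
      | succ k ih =>
        have hk := h k
        push_cast
        rw [show (k : ℤ) + 1 + 2 = k + 3 by ring, show (k : ℤ) + 1 + 1 = k + 2 by ring]
        refine ⟨?_, ?_, ?_⟩ <;> linarith [ih.1, ih.2.1, ih.2.2]
    intro m hm
    have := (key (m - 2).toNat).1
    rwa [Int.toNat_of_nonneg (by omega), sub_add_cancel] at this
  · have key : ∀ k : ℕ, e (-2 - k) ≤ 0 ∧ 0 ≤ e (-2 - k + 1) - e (-2 - k) ∧
        e (-2 - k + 2) - 2 * e (-2 - k + 1) + e (-2 - k) ≤ 0 := by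
      intro k
      induction k with
      | zero => norm_num [h3]; constructor <;> linarith
      | succ k ih =>
        have hk := h (-2 - k - 1)
        push_cast
        rw [show (-2 : ℤ) - k - 1 + 3 = -2 - k + 2 by ring,
          show (-2 : ℤ) - k - 1 + 2 = -2 - k + 1 by ring,
          show (-2 : ℤ) - k - 1 + 1 = -2 - k by ring] at hk
        rw [show (-2 : ℤ) - (k + 1) + 2 = -2 - k + 1 by ring,
          show (-2 : ℤ) - (k + 1) + 1 = -2 - k by ring,
          show (-2 : ℤ) - (k + 1) = -2 - k - 1 by ring]
        refine ⟨?_, ?_, ?_⟩ <;> linarith [ih.1, ih.2.1, ih.2.2]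
    intro m hm
    have := (key (-2 - m).toNat).1
    rwa [Int.toNat_of_nonneg (by omega), sub_sub_cancel] at this

/-- `M` bounds the third divided differences `[1, 2, -2, m]T` for `|m| ≥ 3`. -/
def DivDiffBound (T : ℤ → ℝ) (M : ℝ) : Prop :=
  ∀ m : ℤ, (2 ≤ m → |interpErr T m| ≤ M * (((m : ℝ) - 1) * (m - 2) * (m + 2))) ∧
    (m ≤ -2 → |interpErr T m| ≤ M * -(((m : ℝ) - 1) * (m - 2) * (m + 2)))

/-- The comparison functions are M(m - 1)(m - 2)(m + 2) ± `interpErr T m`: the cubic has third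
difference 6M, and subtracting a quadratic interpolant leaves those of T unchanged. -/
lemma divDiffBound_of_third_diff {T : ℤ → ℝ} {M : ℝ}
    (h : ∀ j, |T (j + 3) - 3 * T (j + 2) + 3 * T (j + 1) - T j| ≤ 6 * M) :
    DivDiffBound T M := by
  have hsub := sign_of_third_diff_nonneg
    (e := fun m => M * (((m : ℝ) - 1) * (m - 2) * (m + 2)) - interpErr T m)
    (fun j => by
      have := (abs_le.1 (h j)).2
      simp only [interpErr]; push_cast; linarith)
    (by norm_num [interpErr]) (by norm_num [interpErr]) (by norm_num [interpErr])
  have hadd := sign_of_third_diff_nonneg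
    (e := fun m => M * (((m : ℝ) - 1) * (m - 2) * (m + 2)) + interpErr T m)
    (fun j => by
      have := (abs_le.1 (h j)).1
      simp only [interpErr]; push_cast; linarith)
    (by norm_num [interpErr]) (by norm_num [interpErr]) (by norm_num [interpErr])
  intro m
  refine ⟨fun hm => abs_le.2 ⟨?_, ?_⟩, fun hm => abs_le.2 ⟨?_, ?_⟩⟩
  · linarith [hadd.1 m hm]
  · linarith [hsub.1 m hm]
  · linarith [hsub.2 m hm]
  · linarith [hadd.2 m hm]

/-- The worst node is m = 3, where the absolute weights sum to 16/3 and the cubic equals 10. -/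
lemma divDiffBound_of_abs_le_one {T : ℤ → ℝ} (h : ∀ j, |T j| ≤ 1) :
    DivDiffBound T (8 / 15) := by
  have tri : ∀ b c d : ℝ, 0 ≤ b → 0 ≤ c → 0 ≤ d → ∀ m : ℤ,
      |T m + b * T 1 - c * T 2 - d * T (-2)| ≤ 1 + b + c + d := by
    intro b c d hb hc hd m
    have h0 := abs_le.1 (h m)
    have h1 := abs_le.1 (h 1)
    have h2 := abs_le.1 (h 2)
    have h3 := abs_le.1 (h (-2))
    refine abs_le.2 ⟨?_, ?_⟩ <;> nlinarith
  intro m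
  constructor
  · intro hm
    rcases hm.eq_or_lt with rfl | hm
    · norm_num [interpErr]
    have hm' : (3 : ℝ) ≤ m := by exact_mod_cast hm
    refine (tri _ _ _ ?_ ?_ ?_ m).trans ?_
    · exact div_nonneg (mul_nonneg (by linarith) (by linarith)) (by norm_num)
    · exact div_nonneg (mul_nonneg (by linarith) (by linarith)) (by norm_num)
    · exact div_nonneg (mul_nonneg (by linarith) (by linarith)) (by norm_num)
    · obtain ⟨u, hu⟩ : ∃ u : ℝ, m = u + 3 := ⟨m - 3, by ring⟩
      rw [hu] at hm' ⊢
      have hu0 : 0 ≤ u := by linarith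
      nlinarith [pow_nonneg hu0 2, pow_nonneg hu0 3]
  · intro hm
    rcases hm.eq_or_lt with rfl | hm
    · norm_num [interpErr]
    have hm' : (m : ℝ) ≤ -3 := by
      have : m ≤ -3 := by omega
      exact_mod_cast this
    refine (tri _ _ _ ?_ ?_ ?_ m).trans ?_
    · exact div_nonneg (mul_nonneg_of_nonpos_of_nonpos (by linarith) (by linarith)) (by norm_num)
    · exact div_nonneg (mul_nonneg_of_nonpos_of_nonpos (by linarith) (by linarith)) (by norm_num)
    · exact div_nonneg (mul_nonneg_of_nonpos_of_nonpos (by linarith) (by linarith)) (by norm_num)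
    · obtain ⟨u, hu⟩ : ∃ u : ℝ, m = -u - 3 := ⟨-m - 3, by ring⟩
      rw [hu] at hm' ⊢
      have hu0 : 0 ≤ u := by linarith
      nlinarith [pow_nonneg hu0 2, pow_nonneg hu0 3]

/-! ### Scalar form of the operators -/

/-- The weights of the third order operator with shifts `1, 2, 1, -2`. -/
noncomputable def thirdOrder (α : ℝ) (T : ℤ → ℝ) : ℝ :=
  (12 - 2 * α) / 9 * T 1 - (3 - α) / 6 * T 2 + (3 + α) / 18 * T (-2)

/-- Scalar version of `A2`. -/
noncomputable def S2 (T : ℤ → ℝ) (p q : ℤ) : ℝ :=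
  ((q : ℝ) / (q - p)) * T p + ((p : ℝ) / (p - q)) * T q

/-- Scalar version of `A3`. -/
noncomputable def S3 (α : ℝ) (T : ℤ → ℝ) (p q r s : ℤ) : ℝ :=
  ((3 * r * s + 2 * α) / (3 * ((r : ℝ) * s - p * q))) * S2 T p q +
    ((3 * p * q + 2 * α) / (3 * ((p : ℝ) * q - r * s))) * S2 T r s

/-- Scalar version of `A4`. -/
noncomputable def S4 (α : ℝ) (T : ℤ → ℝ) (p q r s p' q' r' s' : ℤ) : ℝ :=
  (a p q r s * b α p' q' r' s' /
      (a p q r s * b α p' q' r' s' - a p' q' r' s' * b α p q r s)) * S3 α T p q r s +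
    (a p' q' r' s' * b α p q r s /
      (a p' q' r' s' * b α p q r s - a p q r s * b α p' q' r' s')) * S3 α T p' q' r' s'

lemma A4_eq_sum (α : ℝ) (p q r s p' q' r' s' : ℤ) :
    ∃ (c : Fin 8 → ℝ) (P : Fin 8 → ℤ),
      (∀ n, A4 α n p q r s p' q' r' s' = ∑ k, c k • A1 α n (P k)) ∧
      ∀ T : ℤ → ℝ, S4 α T p q r s p' q' r' s' = ∑ k, c k * T (P k) := by
  set w := a p q r s * b α p' q' r' s' /
      (a p q r s * b α p' q' r' s' - a p' q' r' s' * b α p q r s) with hw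
  set w' := a p' q' r' s' * b α p q r s /
      (a p' q' r' s' * b α p q r s - a p q r s * b α p' q' r' s') with hw'
  refine ⟨![w * ((3 * r * s + 2 * α) / (3 * ((r : ℝ) * s - p * q)) * (q / (q - p))),
    w * ((3 * r * s + 2 * α) / (3 * ((r : ℝ) * s - p * q)) * (p / (p - q))),
    w * ((3 * p * q + 2 * α) / (3 * ((p : ℝ) * q - r * s)) * (s / (s - r))),
    w * ((3 * p * q + 2 * α) / (3 * ((p : ℝ) * q - r * s)) * (r / (r - s))),
    w' * ((3 * r' * s' + 2 * α) / (3 * ((r' : ℝ) * s' - p' * q')) * (q' / (q' - p'))),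
    w' * ((3 * r' * s' + 2 * α) / (3 * ((r' : ℝ) * s' - p' * q')) * (p' / (p' - q'))),
    w' * ((3 * p' * q' + 2 * α) / (3 * ((p' : ℝ) * q' - r' * s')) * (s' / (s' - r'))),
    w' * ((3 * p' * q' + 2 * α) / (3 * ((p' : ℝ) * q' - r' * s')) * (r' / (r' - s')))],
    ![p, q, r, s, p', q', r', s'], fun n => ?_, fun T => ?_⟩
  · rw [A4, ← hw, ← hw', A3, A3, A2, A2, A2, A2, Fin.sum_univ_eight]
    simp only [Matrix.cons_val, smul_add, smul_smul]
    abel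
  · rw [S4, ← hw, ← hw', S3, S3, S2, S2, S2, S2, Fin.sum_univ_eight]
    simp only [Matrix.cons_val]
    ring

lemma negDef_of_S4_neg {α : ℝ} (h1 : 1 < α) (h2 : α < 2) (n : ℕ) (p q r s p' q' r' s' : ℤ)
    (H : ∀ θ ψ, IsPhase (Real.sin (θ / 2)) (Real.cos (θ / 2)) ψ →
      S4 α (fun m => Real.cos (α * ψ + m * θ)) p q r s p' q' r' s' < 0) :
    EigenvaluesNegRe (A4 α n p q r s p' q' r' s') ∧ IsNegDef (A4 α n p q r s p' q' r' s') ∧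
      IsNegDef (A4 α n p q r s p' q' r' s').transpose := by
  obtain ⟨c, P, hA, hS⟩ := A4_eq_sum α p q r s p' q' r' s'
  have h : IsNegDef (A4 α n p q r s p' q' r' s') := by
    rw [hA]
    refine isNegDef_of_genFun_re_neg h1 h2 n c P (genFun_re_neg_of_phase c P fun θ ψ hψ => ?_)
    rw [← hS fun m => Real.cos (α * ψ + m * θ)]
    exact H θ ψ hψ
  exact ⟨h.eigenvaluesNegRe, h, h.transpose⟩

/-! ### Trigonometric values and negativity of the scalar sums -/

section Trig

variable (y θ : ℝ)

lemma cos_sub_cos_third_diff (j : ℤ) :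
    Real.cos (y + (j + 3 : ℤ) * θ) - 3 * Real.cos (y + (j + 2 : ℤ) * θ) +
      3 * Real.cos (y + (j + 1 : ℤ) * θ) - Real.cos (y + j * θ) =
      8 * Real.sin (θ / 2) ^ 3 * Real.sin (y + (j + 3 / 2) * θ) := by
  set β := y + ((j : ℝ) + 3 / 2) * θ with hβ
  set σ := θ / 2 with hσ
  have e0 : y + (j : ℝ) * θ = β - 3 * σ := by rw [hβ, hσ]; ring
  have e1 : y + ((j + 1 : ℤ) : ℝ) * θ = β - σ := by rw [hβ, hσ]; push_cast; ring
  have e2 : y + ((j + 2 : ℤ) : ℝ) * θ = β + σ := by rw [hβ, hσ]; push_cast; ring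
  have e3 : y + ((j + 3 : ℤ) : ℝ) * θ = β + 3 * σ := by rw [hβ, hσ]; push_cast; ring
  rw [e0, e1, e2, e3, Real.cos_add β (3 * σ), Real.cos_add β σ, Real.cos_sub β, Real.cos_sub β,
    Real.sin_three_mul]
  ring

lemma cos_values :
    Real.cos θ = 1 - 2 * Real.sin (θ / 2) ^ 2 ∧
      Real.sin θ = 2 * Real.sin (θ / 2) * Real.cos (θ / 2) := by
  constructor
  · rw [show θ = 2 * (θ / 2) by ring, Real.cos_two_mul, Real.cos_sq']; ring_nf
  · rw [show θ = 2 * (θ / 2) by ring, Real.sin_two_mul]; ring_nf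

lemma cos_shift_values :
    let s := Real.sin (θ / 2)
    let c := Real.cos (θ / 2)
    let T : ℤ → ℝ := fun m => Real.cos (y + m * θ)
    T 0 = Real.cos y ∧
    T 1 = (1 - 2 * s ^ 2) * Real.cos y - 2 * s * c * Real.sin y ∧
    T (-1) = (1 - 2 * s ^ 2) * Real.cos y + 2 * s * c * Real.sin y ∧
    T 2 = (2 * (1 - 2 * s ^ 2) ^ 2 - 1) * Real.cos y - 4 * s * c * (1 - 2 * s ^ 2) * Real.sin y ∧
    T (-2) = (2 * (1 - 2 * s ^ 2) ^ 2 - 1) * Real.cos y +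
      4 * s * c * (1 - 2 * s ^ 2) * Real.sin y := by
  obtain ⟨hc, hs⟩ := cos_values θ
  refine ⟨by simp, ?_, ?_, ?_, ?_⟩
  · simp only [Int.cast_one, one_mul]
    rw [Real.cos_add, hc, hs]; ring
  · simp only [Int.cast_neg, Int.cast_one, neg_mul, one_mul]
    rw [← sub_eq_add_neg, Real.cos_sub, hc, hs]; ring
  · simp only [Int.cast_ofNat]
    rw [Real.cos_add, Real.cos_two_mul, Real.sin_two_mul, hc, hs]; ring
  · simp only [Int.cast_neg, Int.cast_ofNat, neg_mul]
    rw [← sub_eq_add_neg, Real.cos_sub, Real.cos_two_mul, Real.sin_two_mul, hc, hs]; ring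

end Trig

/-- A convex function of α lies below its chord; |13α - 24| is 11 at α = 1 and 2 at α = 2. -/
lemma abs_weight_le {α : ℝ} (h1 : 1 < α) (h2 : α < 2) {M : ℝ} (hM : 0 ≤ M) :
    |13 * α - 24| / 6 * M ≤ (2 - α) * (11 / 6 * M) + (α - 1) * (1 / 3 * M) := by
  have : |13 * α - 24| / 6 ≤ (2 - α) * (11 / 6) + (α - 1) * (1 / 3) := by
    rcases abs_cases (13 * α - 24) with h | h <;> linarith
  nlinarith

lemma third_order_add_neg {α θ ψ : ℝ} (h1 : 1 < α) (h2 : α < 2)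
    (h : IsPhase (Real.sin (θ / 2)) (Real.cos (θ / 2)) ψ) :
    ∃ M, 0 ≤ M ∧ DivDiffBound (fun m => Real.cos (α * ψ + m * θ)) M ∧
      thirdOrder α (fun m => Real.cos (α * ψ + m * θ)) + |13 * α - 24| / 6 * M < 0 := by
  obtain ⟨-, e1, -, e2, e3⟩ := cos_shift_values (α * ψ) θ
  have e : thirdOrder α (fun m => Real.cos (α * ψ + m * θ)) =
      ((2 - α) * ((9 - 12 * Real.sin (θ / 2) ^ 2 - 8 * (Real.sin (θ / 2) ^ 2) ^ 2) / 9) +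
        (α - 1) * ((9 - 24 * Real.sin (θ / 2) ^ 2 + 8 * (Real.sin (θ / 2) ^ 2) ^ 2) / 9)) *
        Real.cos (α * ψ) -
      ((2 - α) * (Real.sin (θ / 2) ^ 3 * Real.cos (θ / 2) * (40 / 9)) +
        (α - 1) * (Real.sin (θ / 2) ^ 3 * Real.cos (θ / 2) * (32 / 9))) *
        Real.sin (α * ψ) := by
    simp only at e1 e2 e3
    rw [thirdOrder, e1, e2, e3]
    ring
  have hs := h.s_pos
  rcases le_total (Real.sin (θ / 2) ^ 2) (11 / 20) with hx | hx
  -- Third differences of the cosine are at most 8s³ = 6M.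
  · refine ⟨4 / 3 * Real.sin (θ / 2) ^ 3, by positivity, divDiffBound_of_third_diff fun j => ?_, ?_⟩
    · rw [cos_sub_cos_third_diff, abs_mul, abs_of_pos (by positivity)]
      have := mul_le_of_le_one_right (a := 8 * Real.sin (θ / 2) ^ 3) (by positivity)
        (Real.abs_sin_le_one (α * ψ + (j + 3 / 2) * θ))
      linarith
    · have := h.third_order_neg_of_le h1 h2 hx
      have := abs_weight_le h1 h2 (M := 4 / 3 * Real.sin (θ / 2) ^ 3) (by positivity)
      linarith
  · refine ⟨8 / 15, by norm_num, divDiffBound_of_abs_le_one fun j => Real.abs_cos_le_one _, ?_⟩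
    have := h.third_order_neg_of_ge h1 h2 hx
    have := abs_weight_le h1 h2 (M := 8 / 15) (by positivity)
    linarith

/-- The factor of `lam` is the divided difference of T at -2, …, 2, equal to 2/3 s⁴ cos(αψ). The sum
is affine in `lam`, so the sign of the cosine selects the extreme value to be tested. -/
lemma fourth_order_neg {α θ ψ lam : ℝ} (h1 : 1 < α) (h2 : α < 2)
    (h : IsPhase (Real.sin (θ / 2)) (Real.cos (θ / 2)) ψ)
    (hl : (16 * α - 42) / 3 ≤ lam) (hu : lam ≤ 11 / 6 - 5 / 3 * (α - 1)) :
    thirdOrder α (fun m => Real.cos (α * ψ + m * θ)) +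
      (24 - 13 * α) / 36 * interpErr (fun m => Real.cos (α * ψ + m * θ)) (-1) +
      lam * (interpErr (fun m => Real.cos (α * ψ + m * θ)) 0 / 4 -
        interpErr (fun m => Real.cos (α * ψ + m * θ)) (-1) / 6) < 0 := by
  obtain ⟨e0, e1, e1', e2, e3⟩ := cos_shift_values (α * ψ) θ
  have hup := h.fourth_order_neg_upper h1 h2
  have hlo := h.fourth_order_neg_lower h1 h2
  simp only [thirdOrder, interpErr]
  simp only at e0 e1 e1' e2 e3
  rw [e0, e1, e1', e2, e3]
  set s := Real.sin (θ / 2)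
  set c := Real.cos (θ / 2)
  set C := Real.cos (α * ψ)
  set S := Real.sin (α * ψ)
  rcases le_total C 0 with hC | hC
  · have := mul_le_mul_of_nonpos_right hl (mul_nonpos_of_nonneg_of_nonpos
      (show 0 ≤ 2 / 3 * s ^ 4 by positivity) hC)
    push_cast
    linarith
  · have := mul_le_mul_of_nonneg_right hu (mul_nonneg
      (show 0 ≤ 2 / 3 * s ^ 4 by positivity) hC)
    push_cast
    linarith

/-! ### Decomposition of the third and fourth order operators -/

/-- Both operators have moments 1, 0, 2α/3 of orders 0, 1, 2, so they agree on the quadratic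
interpolant of T at 1, 2, -2 and only its errors at q and s remain. -/
lemma S3_one_one (α : ℝ) (T : ℤ → ℝ) {q s : ℤ} (hq : q ≠ 1) (hs : s ≠ 1) (hqs : q ≠ s) :
    S3 α T 1 q 1 s = thirdOrder α T +
      (2 * α + 3 * s) / (3 * ((q : ℝ) - s) * (q - 1)) * interpErr T q +
      (3 * q + 2 * α) / (3 * ((q : ℝ) - s) * (1 - s)) * interpErr T s := by
  have h1 : (q : ℝ) - 1 ≠ 0 := sub_ne_zero.2 (by exact_mod_cast hq)
  have h2 : (1 : ℝ) - s ≠ 0 := sub_ne_zero.2 (by exact_mod_cast hs.symm)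
  have h3 : (q : ℝ) - s ≠ 0 := sub_ne_zero.2 (by exact_mod_cast hqs)
  have h1' : (1 : ℝ) - q ≠ 0 := by rw [← neg_sub]; exact neg_ne_zero.2 h1
  have h2' : (s : ℝ) - 1 ≠ 0 := by rw [← neg_sub]; exact neg_ne_zero.2 h2
  have h3' : (s : ℝ) - q ≠ 0 := by rw [← neg_sub]; exact neg_ne_zero.2 h3
  simp only [S3, S2, thirdOrder, interpErr, Int.cast_one, mul_one, one_mul]
  generalize (q : ℝ) = x at *
  generalize (s : ℝ) = y at *
  field_simp
  ring

lemma S3_two_neg_two (α : ℝ) (T : ℤ → ℝ) : S3 α T 1 2 1 (-2) = thirdOrder α T := by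
  rw [S3_one_one α T (by norm_num) (by norm_num) (by norm_num)]
  norm_num [interpErr]

/-- The two fourth order weights sum to 1, so `thirdOrder` survives unchanged; the quantity in `hδ`
is their common denominator up to the factor 4(q - s). -/
lemma S4_case_one {α : ℝ} (T : ℤ → ℝ) {q s : ℤ} (hq : q ≠ 1) (hs : s ≠ 1) (hqs : q ≠ s)
    (hδ : 6 * (q : ℝ) * s + 4 * α * (q + s) + 24 ≠ 0) :
    S4 α T 1 2 1 (-2) 1 q 1 s = thirdOrder α T +
      (13 * α - 24) / (-(6 * (q : ℝ) * s + 4 * α * (q + s) + 24)) *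
        ((2 * α + 3 * s) / (3 * ((q : ℝ) - s) * (q - 1)) * interpErr T q +
          (3 * q + 2 * α) / (3 * ((q : ℝ) - s) * (1 - s)) * interpErr T s) := by
  have h3 : (q : ℝ) - s ≠ 0 := sub_ne_zero.2 (by exact_mod_cast hqs)
  set δ := 6 * (q : ℝ) * s + 4 * α * (q + s) + 24 with hδ'
  have ea : a 1 2 1 (-2) = -4 := by norm_num [a]
  have eb : b α 1 2 1 (-2) = -4 * (13 * α - 24) := by norm_num [b]; ring
  have ea' : a 1 q 1 s = -(q - s) := by simp [a]
  have eb' : b α 1 q 1 s = -(q - s) * (13 * α - 24 + δ) := by simp [b, hδ']; ring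
  rw [S4, S3_two_neg_two, S3_one_one α T hq hs hqs, ea, eb, ea', eb']
  have w1 : -4 * (-((q : ℝ) - s) * (13 * α - 24 + δ)) /
      (-4 * (-((q : ℝ) - s) * (13 * α - 24 + δ)) - -((q : ℝ) - s) * (-4 * (13 * α - 24))) =
      1 - (13 * α - 24) / -δ := by
    rw [show -4 * (-((q : ℝ) - s) * (13 * α - 24 + δ)) -
      -((q : ℝ) - s) * (-4 * (13 * α - 24)) = 4 * (q - s) * δ by ring]
    field_simp
    ring
  have w2 : -((q : ℝ) - s) * (-4 * (13 * α - 24)) /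
      (-((q : ℝ) - s) * (-4 * (13 * α - 24)) - -4 * (-((q : ℝ) - s) * (13 * α - 24 + δ))) =
      (13 * α - 24) / -δ := by
    rw [show -((q : ℝ) - s) * (-4 * (13 * α - 24)) -
      -4 * (-((q : ℝ) - s) * (13 * α - 24 + δ)) = 4 * (q - s) * -δ by ring]
    field_simp
  rw [w1, w2]
  ring

/-- Exchanging the pairs negates both a' and b', which cancels in the weights; this reduces case 1
to q' > 0 > s'. -/
lemma S4_swap (α : ℝ) (T : ℤ → ℝ) (p q r s p' q' r' s' : ℤ) :
    S4 α T p q r s r' s' p' q' = S4 α T p q r s p' q' r' s' := by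
  have ea : a r' s' p' q' = -a p' q' r' s' := by simp [a]
  have eb : b α r' s' p' q' = -b α p' q' r' s' := by simp [b]; ring
  have e3 : S3 α T r' s' p' q' = S3 α T p' q' r' s' := by simp only [S3]; ring
  simp only [S4, ea, eb, e3]
  congr 2
  · rw [show a p q r s * -b α p' q' r' s' - -a p' q' r' s' * b α p q r s =
      -(a p q r s * b α p' q' r' s' - a p' q' r' s' * b α p q r s) by ring, mul_neg, neg_div_neg_eq]
  · rw [show -a p' q' r' s' * b α p q r s - a p q r s * -b α p' q' r' s' =
      -(a p' q' r' s' * b α p q r s - a p q r s * b α p' q' r' s') by ring, neg_mul, neg_div_neg_eq]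

lemma nondegenerate_case_one {α : ℝ} {q s : ℤ} (h : Nondegenerate α 1 2 1 (-2) 1 q 1 s) :
    6 * (q : ℝ) * s + 4 * α * (q + s) + 24 ≠ 0 := by
  intro h0
  apply h
  simp only [a, b]
  push_cast
  linear_combination 4 * ((q : ℝ) - s) * h0

lemma S4_case_one_neg {α : ℝ} (h1 : 1 < α) (h2 : α < 2) {T : ℤ → ℝ} {M : ℝ}
    (hT : DivDiffBound T M) (hneg : thirdOrder α T + |13 * α - 24| / 6 * M < 0) {q s : ℤ}
    (hq : 2 ≤ q) (hs : s ≤ -2) (hδ : 6 * (q : ℝ) * s + 4 * α * (q + s) + 24 ≠ 0) :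
    S4 α T 1 2 1 (-2) 1 q 1 s < 0 := by
  rw [S4_case_one T (by omega) (by omega) (by omega) hδ]
  have hqb := (hT q).1 hq
  have hsb := (hT s).2 hs
  have hq' : (2 : ℝ) ≤ q := by exact_mod_cast hq
  have hs' : (s : ℝ) ≤ -2 := by exact_mod_cast hs
  generalize interpErr T q = eq at *
  generalize interpErr T s = es at *
  generalize (q : ℝ) = x at *
  generalize (s : ℝ) = y at *
  set δ := -(6 * x * y + 4 * α * (x + y) + 24) with hδdef
  have hδ0 : 0 < δ := by
    refine lt_of_le_of_ne ?_ (by rw [hδdef]; exact (neg_ne_zero.2 hδ).symm)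
    have u0 : 0 ≤ x - 2 := by linarith
    have v0 : 0 ≤ -y - 2 := by linarith
    -- In this form δ is visibly nonnegative.
    have : δ = 6 * ((x - 2) * (-y - 2)) + (12 - 4 * α) * (x - 2) + (12 + 4 * α) * (-y - 2) := by
      rw [hδdef]; ring
    rw [this]
    have := mul_nonneg u0 v0
    have := mul_nonneg (show 0 ≤ 12 - 4 * α by linarith) u0
    have := mul_nonneg (show 0 ≤ 12 + 4 * α by linarith) v0
    linarith
  have hx1 : 0 < x - 1 := by linarith
  have hy1 : 0 < 1 - y := by linarith
  have hxy : 0 < x - y := by linarith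
  have c1 : (2 * α + 3 * y) / (3 * (x - y) * (x - 1)) ≤ 0 :=
    div_nonpos_of_nonpos_of_nonneg (by linarith) (by positivity)
  have c2 : 0 ≤ (3 * x + 2 * α) / (3 * (x - y) * (1 - y)) :=
    div_nonneg (by linarith) (by positivity)
  have key : |(2 * α + 3 * y) / (3 * (x - y) * (x - 1)) * eq +
      (3 * x + 2 * α) / (3 * (x - y) * (1 - y)) * es| ≤ M * (δ / 6) := by
    refine (abs_add_le _ _).trans ?_
    rw [abs_mul, abs_mul, abs_of_nonpos c1, abs_of_nonneg c2]
    refine (add_le_add (mul_le_mul_of_nonneg_left hqb (neg_nonneg.2 c1))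
      (mul_le_mul_of_nonneg_left hsb c2)).trans_eq ?_
    -- The coefficients have opposite signs, as do the cubics at x and y, so the two bounds add up
    -- to exactly Mδ/6, and δ cancels in `habs`.
    rw [hδdef]
    field_simp
    ring
  have habs : (13 * α - 24) / δ * ((2 * α + 3 * y) / (3 * (x - y) * (x - 1)) * eq +
      (3 * x + 2 * α) / (3 * (x - y) * (1 - y)) * es) ≤ |13 * α - 24| / 6 * M := by
    refine (le_abs_self _).trans ?_
    rw [abs_mul, abs_div, abs_of_pos hδ0]
    refine (mul_le_mul_of_nonneg_left key (by positivity)).trans_eq ?_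
    field_simp
  linarith

lemma S4_eq_of_values {α : ℝ} (T : ℤ → ℝ) {p q r s p' q' r' s' : ℤ} {a₁ b₁ a₂ b₂ d x y : ℝ}
    (ha : a p q r s = a₁) (hb : b α p q r s = b₁) (ha' : a p' q' r' s' = a₂)
    (hb' : b α p' q' r' s' = b₂) (hd : a₁ * b₂ - a₂ * b₁ = d)
    (hx : S3 α T p q r s = thirdOrder α T + x) (hy : S3 α T p' q' r' s' = thirdOrder α T + y)
    (hnd : Nondegenerate α p q r s p' q' r' s') :
    d ≠ 0 ∧ S4 α T p q r s p' q' r' s' = thirdOrder α T + (a₁ * b₂ * x - a₂ * b₁ * y) / d := by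
  have hd0 : d ≠ 0 := by
    rw [← hd, ← ha, ← hb, ← ha', ← hb']
    exact sub_ne_zero.2 hnd
  refine ⟨hd0, ?_⟩
  rw [S4, ha, hb, ha', hb', hx, hy, ← neg_sub (a₁ * b₂), hd]
  field_simp
  linear_combination thirdOrder α T * hd

/-- The bounds for `lam` are affine in α: the lower is the chord of the second tuple's value, the
upper joins 11/6 (first and sixth tuples, α = 1) to 1/6 (fifth, α = 2). -/
lemma S4_special {α : ℝ} (h1 : 1 < α) (h2 : α < 2) (T : ℤ → ℝ) {p q r s p' q' r' s' : ℤ}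
    (hmem : (p, q, r, s, p', q', r', s') ∈ specialTuples)
    (hnd : Nondegenerate α p q r s p' q' r' s') :
    ∃ lam, (16 * α - 42) / 3 ≤ lam ∧ lam ≤ 11 / 6 - 5 / 3 * (α - 1) ∧
      S4 α T p q r s p' q' r' s' = thirdOrder α T +
        (24 - 13 * α) / 36 * interpErr T (-1) +
        lam * (interpErr T 0 / 4 - interpErr T (-1) / 6) := by
  have third : ∀ {q s : ℤ}, q ≠ 1 → s ≠ 1 → q ≠ s → S3 α T 1 q 1 s = thirdOrder α T +
      ((2 * α + 3 * s) / (3 * ((q : ℝ) - s) * (q - 1)) * interpErr T q +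
      (3 * q + 2 * α) / (3 * ((q : ℝ) - s) * (1 - s)) * interpErr T s) := fun hq hs hqs => by
    rw [S3_one_one α T hq hs hqs, add_assoc]
  have r2 : interpErr T 2 = 0 := by norm_num [interpErr]
  have r2' : interpErr T (-2) = 0 := by norm_num [interpErr]
  simp only [specialTuples, mem_insert_iff, mem_singleton_iff, Prod.mk.injEq] at hmem
  have n1 : α + 3 ≠ 0 := by linarith
  have n2 : 3 - 5 * α ≠ 0 := by linarith
  have n3 : α - 6 ≠ 0 := by linarith
  have n4 : α - 3 ≠ 0 := by linarith
  have hsq : 0 < (α - 1) * (2 - α) := mul_pos (by linarith) (by linarith)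
  rcases hmem with h | h | h | h | h | h | h <;>
    obtain ⟨rfl, rfl, rfl, rfl, rfl, rfl, rfl, rfl⟩ := h
  -- The shift -1 does not occur, so `lam` must cancel the coefficient of T(-1).
  · refine ⟨(24 - 13 * α) / 6, by linarith, by linarith, ?_⟩
    obtain ⟨hd, e⟩ := S4_eq_of_values (a₁ := -2) (b₁ := -42 * α) (a₂ := -4) (b₂ := 96 - 52 * α)
      (d := -64 * (α + 3)) T (by norm_num [a]) (by norm_num [b]; try ring) (by norm_num [a])
      (by norm_num [b]; try ring) (by ring) (third (by norm_num) (by norm_num) (by norm_num))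
      (third (by norm_num) (by norm_num) (by norm_num)) hnd
    rw [e, add_assoc, add_right_inj]
    norm_num [r2, r2']
    field_simp
    ring
  · refine ⟨(3 + α) * (12 + α) / (3 * (3 - 5 * α)), ?_, ?_, ?_⟩
    · rw [le_div_iff_of_neg (by linarith)]; nlinarith
    · rw [div_le_iff_of_neg (by linarith)]; nlinarith
    · obtain ⟨hd, e⟩ := S4_eq_of_values (a₁ := -2) (b₁ := -42 * α) (a₂ := -1) (b₂ := -12 - α)
        (d := 8 * (3 - 5 * α)) T (by norm_num [a]) (by norm_num [b]; try ring) (by norm_num [a])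
        (by norm_num [b]; try ring) (by ring) (third (by norm_num) (by norm_num) (by norm_num))
        (third (by norm_num) (by norm_num) (by norm_num)) hnd
      rw [e, add_assoc, add_right_inj]
      norm_num [r2, r2']
      generalize ht : 3 - 5 * α = t at *
      obtain rfl : α = (3 - t) / 5 := by linarith
      field_simp
      ring
  -- The shift 0 does not occur, which forces `lam` = 0.
  · refine ⟨0, by linarith, by linarith, ?_⟩
    obtain ⟨hd, e⟩ := S4_eq_of_values (a₁ := -3) (b₁ := 36 - 51 * α) (a₂ := -4) (b₂ := 96 - 52 * α)
      (d := -48 * (α + 3)) T (by norm_num [a]) (by norm_num [b]; try ring) (by norm_num [a])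
      (by norm_num [b]; try ring) (by ring) (third (by norm_num) (by norm_num) (by norm_num))
      (third (by norm_num) (by norm_num) (by norm_num)) hnd
    rw [e, add_assoc, add_right_inj]
    norm_num [r2, r2']
    field_simp
    ring
  · refine ⟨0, by linarith, by linarith, ?_⟩
    obtain ⟨hd, e⟩ := S4_eq_of_values (a₁ := -3) (b₁ := 36 - 51 * α) (a₂ := -1) (b₂ := -12 - α)
      (d := 24 * (3 - 2 * α)) T (by norm_num [a]) (by norm_num [b]; try ring) (by norm_num [a])
      (by norm_num [b]; try ring) (by ring) (third (by norm_num) (by norm_num) (by norm_num))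
      (third (by norm_num) (by norm_num) (by norm_num)) hnd
    have n5 : 3 - 2 * α ≠ 0 := right_ne_zero_of_mul hd
    rw [e, add_assoc, add_right_inj]
    norm_num [r2, r2']
    generalize ht : 3 - 2 * α = t at *
    obtain rfl : α = (3 - t) / 2 := by linarith
    field_simp
    ring
  · refine ⟨(13 * α - 24) * (3 - 2 * α) / (3 * (α - 6)), ?_, ?_, ?_⟩
    · rw [le_div_iff_of_neg (by linarith)]; nlinarith
    · rw [div_le_iff_of_neg (by linarith)]; nlinarith
    · obtain ⟨hd, e⟩ := S4_eq_of_values (a₁ := -1) (b₁ := -9 * α) (a₂ := -4) (b₂ := 96 - 52 * α)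
        (d := 16 * (α - 6)) T (by norm_num [a]) (by norm_num [b]; try ring) (by norm_num [a])
        (by norm_num [b]; try ring) (by ring) (third (by norm_num) (by norm_num) (by norm_num))
        (third (by norm_num) (by norm_num) (by norm_num)) hnd
      rw [e, add_assoc, add_right_inj]
      norm_num [r2, r2']
      field_simp
      ring
  · refine ⟨(24 - 13 * α) / 6, by linarith, by linarith, ?_⟩
    obtain ⟨hd, e⟩ := S4_eq_of_values (a₁ := -2) (b₁ := -10 * α) (a₂ := -4) (b₂ := 96 - 52 * α)
      (d := 64 * (α - 3)) T (by norm_num [a]) (by norm_num [b]; try ring) (by norm_num [a])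
      (by norm_num [b]; try ring) (by ring) (third (by norm_num) (by norm_num) (by norm_num))
      (third (by norm_num) (by norm_num) (by norm_num)) hnd
    rw [e, add_assoc, add_right_inj]
    norm_num [r2, r2']
    field_simp
    ring
  · refine ⟨0, by linarith, by linarith, ?_⟩
    obtain ⟨hd, e⟩ := S4_eq_of_values (a₁ := -1) (b₁ := -12 - α) (a₂ := -4) (b₂ := 96 - 52 * α)
      (d := 48 * (α - 3)) T (by norm_num [a]) (by norm_num [b]; try ring) (by norm_num [a])
      (by norm_num [b]; try ring) (by ring) (third (by norm_num) (by norm_num) (by norm_num))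
      (third (by norm_num) (by norm_num) (by norm_num)) hnd
    rw [e, add_assoc, add_right_inj]
    norm_num [r2, r2']
    field_simp
    ring

end WSLD

theorem theorem2p11 (α : ℝ) (hα₁ : 1 < α) (hα₂ : α < 2) (n : ℕ) :
    (∀ q' s' : ℤ, 2 ≤ |q'| → 2 ≤ |s'| → (q', s') ≠ (2, -2) → q' * s' < 0 →
      WSLD.Nondegenerate α 1 2 1 (-2) 1 q' 1 s' →
      WSLD.EigenvaluesNegRe (WSLD.A4 α n 1 2 1 (-2) 1 q' 1 s') ∧
      WSLD.IsNegDef (WSLD.A4 α n 1 2 1 (-2) 1 q' 1 s') ∧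
      WSLD.IsNegDef (WSLD.A4 α n 1 2 1 (-2) 1 q' 1 s').transpose) ∧
    (∀ p q r s p' q' r' s' : ℤ, (p, q, r, s, p', q', r', s') ∈ WSLD.specialTuples →
      WSLD.Nondegenerate α p q r s p' q' r' s' →
      WSLD.EigenvaluesNegRe (WSLD.A4 α n p q r s p' q' r' s') ∧
      WSLD.IsNegDef (WSLD.A4 α n p q r s p' q' r' s') ∧
      WSLD.IsNegDef (WSLD.A4 α n p q r s p' q' r' s').transpose) := by
  refine ⟨fun q s hq hs _ hqs hnd => ?_, fun p q r s p' q' r' s' hmem hnd => ?_⟩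
  · refine WSLD.negDef_of_S4_neg hα₁ hα₂ n 1 2 1 (-2) 1 q 1 s fun θ ψ hψ => ?_
    obtain ⟨M, -, hT, hneg⟩ := WSLD.third_order_add_neg hα₁ hα₂ hψ
    have hδ := WSLD.nondegenerate_case_one hnd
    rcases mul_neg_iff.1 hqs with ⟨h0, h0'⟩ | ⟨h0, h0'⟩
    · rw [abs_of_pos h0] at hq
      rw [abs_of_neg h0'] at hs
      exact WSLD.S4_case_one_neg hα₁ hα₂ hT hneg hq (by omega) hδ
    · rw [abs_of_neg h0] at hq
      rw [abs_of_pos h0'] at hs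
      rw [WSLD.S4_swap]
      refine WSLD.S4_case_one_neg hα₁ hα₂ hT hneg hs (by omega) ?_
      rwa [mul_right_comm, add_comm (s : ℝ)]
  · refine WSLD.negDef_of_S4_neg hα₁ hα₂ n p q r s p' q' r' s' fun θ ψ hψ => ?_
    obtain ⟨lam, hl, hu, e⟩ := WSLD.S4_special hα₁ hα₂
      (fun m => Real.cos (α * ψ + m * θ)) hmem hnd
    rw [e]
    exact WSLD.fourth_order_neg hα₁ hα₂ hψ hl hu
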